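/- Let $Q$ be a smooth (Hausdorff, second countable) $n$-manifold, $\tau\colon TT^*Q\to T^*Q$ the projection, and $\omega=-d\theta$ the canonical symplectic form on $T^*Q$ ($\theta_\alpha(w)=\alpha(T\pi\, w)$, where $\pi\colon T^*Q\to Q$). Let $U\subseteq\mathbb R^m$ be a set of controls, and let $X(q,u)\in T_qQ$ and $F(q,u)\in\mathbb R$ be a control-dependent vector field and a cost, smooth on $Q\times\operatorname{int}U$. Let $H(q,p,u)=\langle p,X(q,u)\rangle-F(q,u)$ be Pontryagin's Hamiltonian, and assume that it is a Morse family over $T^*Q\times \operatorname{int}U\to T^*Q$: at every $(q,p,u)$ with $u\in\operatorname{int}U$ and $\frac{\partial H}{\partial u}(q,p,u)=0$ the matrix $D_{(q,p,u)}\big(\frac{\partial H}{\partial u}\big)$ has maximal rank. Put $$\mathcal L_H=\Big\{d_\alpha H(\cdot,u)\in T^*T^*Q \;\Big|\; u\in\operatorname{int}U,\ \tfrac{\partial H}{\partial u}(\alpha,u)=0\Big\},\qquad S_H=\{v\in TT^*Q\mid i_v\omega\in\mathcal L_H\}.$$ The integrability algorithm is $S^0_H=S_H$, $P^k_H=\tau(S^k_H)$,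 $S^{k+1}_H=TP^k_H\cap S^k_H$, where $TA$ is the set of velocities of smooth curves that stay in $A$ (the tangent bundle of $A$ if $A$ is an embedded submanifold). Suppose that it stabilizes at some step $k_f$, that is, $S^{k_f}_H=TP^{k_f}_H\cap S^{k_f}_H$; write $S^f_H=S^{k_f}_H$ and $P^f_H=P^{k_f}_H$. Suppose that $S^f_H\subseteq TT^*Q$ and $P^f_H\subseteq T^*Q$ are embedded submanifolds, of dimensions $r$ and $d$, and that $\tau|_{S^f_H}\colon S^f_H\to P^f_H$ is a submersion. Let $i_f\colon P^f_H\hookrightarrow T^*Q$ be the inclusion and $\omega_f=i_f^*\omega$. For a manifold $M$ with projection $\tau_M\colon TM\to M$ and a form $\eta$ on $M$, let $d_T\eta=d(i_T\eta)+i_T(d\eta)$ be its complete lift to $TM$, where $(i_T\eta)_v(w_1,\dots,w_k)=\eta_{\tau_M(v)}(v,T\tau_M w_1,\dots,T\tau_M w_k)$. A presymplectic form is a smooth closed 2-form. An embedded submanifold $L$ of dimension $r$ of a presymplectic manifold $(M,\eta)$ is Lagrangian if $\eta$ pulls back to $0$ on $L$ and $$r=\frac{\dim M-\dim\ker\eta_x}{2}+\dim(T_xL\cap\ker\eta_x)\qquad\text{for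 all }x\in L.$$ Then $\omega_f$ and $d_T\omega_f$ are presymplectic forms on $P^f_H$ and $TP^f_H$, and $S^f_H$ is contained in $TP^f_H$ and is a Lagrangian submanifold of the presymplectic manifold $(TP^f_H,d_T\omega_f)$. -/

import Mathlib

open Set Bundle Manifold
open scoped ContDiff Manifold Topology Bundle

noncomputable section

namespace PresymplecticOCP

section Forms

variable {E : Type*} [NormedAddCommGroup E] [NormedSpace ℝ E]
  {H : Type*} [TopologicalSpace H]
  {E' : Type*} [NormedAddCommGroup E'] [NormedSpace ℝ E']
  {H' : Type*} [TopologicalSpace H']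

/-- A (not necessarily smooth) differential `k`-form on the manifold `M` modelled on `I`. -/
abbrev DiffForm (I : ModelWithCorners ℝ E H) (M : Type*) [TopologicalSpace M]
    [ChartedSpace H M] (k : ℕ) : Type _ :=
  ∀ x : M, TangentSpace I x [⋀^Fin k]→L[ℝ] ℝ

variable {I : ModelWithCorners ℝ E H} {M : Type*} [TopologicalSpace M] [ChartedSpace H M]
  {I' : ModelWithCorners ℝ E' H'} {M' : Type*} [TopologicalSpace M'] [ChartedSpace H' M']

/-- The coordinate expression of `ω` in the chart centred at `x₀`: the pullback of `ω` by the
inverse of the chart. It is meaningful on the target of the chart. -/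
def DiffForm.inChart {k : ℕ} (η : DiffForm I M k) (x₀ : M) : E → E [⋀^Fin k]→L[ℝ] ℝ :=
  fun y => (η ((extChartAt I x₀).symm y)).compContinuousLinearMap
    (mfderivWithin 𝓘(ℝ, E) I (extChartAt I x₀).symm (range I) y :
      E →L[ℝ] TangentSpace I ((extChartAt I x₀).symm y))

/-- A form is smooth if its coordinate expressions are smooth. -/
def DiffForm.IsSmooth {k : ℕ} (η : DiffForm I M k) : Prop :=
  ∀ x₀ : M, ContDiffOn ℝ ∞ (η.inChart x₀) (extChartAt I x₀).target

/-- The exterior derivative of a form. At the point `x` it is computed in the chart centred at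
`x`; the tangent space at `x` is the model space `E` through the differential of that very
chart. -/
def DiffForm.d {k : ℕ} (η : DiffForm I M k) : DiffForm I M (k + 1) :=
  fun x => (extDerivWithin (η.inChart x) (range I) (extChartAt I x x) : E [⋀^Fin (k + 1)]→L[ℝ] ℝ)

/-- The pullback `f^* ω` of a form by a map. -/
def DiffForm.pullback {k : ℕ} (f : M' → M) (η : DiffForm I M k) : DiffForm I' M' k :=
  fun x => (η (f x)).compContinuousLinearMap (mfderiv I' I f x)

/-- The contraction `i_v ω = ω(v, …)` of an alternating form on a tangent space. -/
def contract {k : ℕ} {x : M} (η : TangentSpace I x [⋀^Fin (k + 1)]→L[ℝ] ℝ)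
    (v : TangentSpace I x) : TangentSpace I x [⋀^Fin k]→L[ℝ] ℝ :=
  ContinuousAlternatingMap.curryLeft (E := E) (𝕜 := ℝ) (F := ℝ) η v

variable [IsManifold I 1 M]

/-- The operator `i_T` from `(k+1)`-forms on `M` to `k`-forms on `TM`:
`(i_T ω)_v (w₁, …, w_k) = ω_{τ(v)} (v, Tτ w₁, …, Tτ w_k)`, where `τ : TM → M`. -/
def DiffForm.iT {k : ℕ} (η : DiffForm I M (k + 1)) : DiffForm I.tangent (TangentBundle I M) k :=
  fun v => (contract (η v.proj) v.snd).compContinuousLinearMap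
    (mfderiv I.tangent I (fun z : TangentBundle I M => z.proj) v)

/-- The complete (tangent) lift `d_T ω = d (i_T ω) + i_T (d ω)` of a form on `M` to `TM`. -/
def DiffForm.dT {k : ℕ} (η : DiffForm I M (k + 1)) :
    DiffForm I.tangent (TangentBundle I M) (k + 1) :=
  fun v => η.iT.d v + η.d.iT v

end Forms

section Presymplectic

variable {E : Type*} [NormedAddCommGroup E] [NormedSpace ℝ E]
  {H : Type*} [TopologicalSpace H] {I : ModelWithCorners ℝ E H}
  {M : Type*} [TopologicalSpace M] [ChartedSpace H M]
  {E' : Type*} [NormedAddCommGroup E'] [NormedSpace ℝ E']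
  {H' : Type*} [TopologicalSpace H']

/-- A presymplectic form is a closed smooth 2-form. -/
structure IsPresymplectic (η : DiffForm I M 2) : Prop where
  smooth : η.IsSmooth
  closed : ∀ x, η.d x = 0

/-- The kernel of a 2-form at a point, `{v | i_v ω_x = 0}`. -/
def kerAt (η : DiffForm I M 2) (x : M) : Submodule ℝ (TangentSpace I x) where
  carrier := {v | ∀ w : TangentSpace I x, η x ![v, w] = 0}
  add_mem' := fun {a b} ha hb w => by
    have h := (η x).toMultilinearMap.cons_add ![w] a b
    exact h.trans (by
      have h1 := ha w
      have h2 := hb w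
      exact (congrArg₂ (· + ·) h1 h2).trans (add_zero 0))
  zero_mem' := fun w => (η x).toMultilinearMap.map_coord_zero 0 rfl
  smul_mem' := fun c a ha w => by
    have h := (η x).toMultilinearMap.cons_smul ![w] c a
    exact h.trans ((congrArg (c • ·) (ha w)).trans (smul_zero c))

/-- The submanifold of `(M, ω)` given by the embedding `f : L → M` is Lagrangian: the pullback of
`ω` to it vanishes, and `dim L = (dim M - dim ker ω) / 2 + dim (TL ∩ ker ω)` at all its points. -/
structure IsLagrangian (J : ModelWithCorners ℝ E' H') {L : Type*} [TopologicalSpace L]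
    [ChartedSpace H' L] (η : DiffForm I M 2) (f : L → M) : Prop where
  embedding : IsSmoothEmbedding J I ∞ f
  isotropic : ∀ s : L, DiffForm.pullback (I' := J) f η s = 0
  dim_eq : ∀ s : L, (Module.finrank ℝ E' : ℚ) =
    ((Module.finrank ℝ E : ℚ) - Module.finrank ℝ (kerAt η (f s))) / 2 +
      Module.finrank ℝ ((mfderiv J I f s).range ⊓ kerAt η (f s) : Submodule ℝ _)

end Presymplectic

section Cotangent

variable {E : Type*} [NormedAddCommGroup E] [NormedSpace ℝ E]
  {H : Type*} [TopologicalSpace H]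

/-- The cotangent bundle of `M`; its points are pairs `⟨x, p⟩` with `p` a linear form on the
tangent space at `x`. -/
abbrev Cotangent (I : ModelWithCorners ℝ E H) (M : Type*) [TopologicalSpace M]
    [ChartedSpace H M] [IsManifold I 1 M] : Type _ :=
  TotalSpace (E →L[ℝ] ℝ) (fun x : M => TangentSpace I x →L[ℝ] Trivial M ℝ x)

/-- The model with corners of the cotangent bundle. -/
abbrev cotangentModel (I : ModelWithCorners ℝ E H) :
    ModelWithCorners ℝ (E × (E →L[ℝ] ℝ)) (ModelProd H (E →L[ℝ] ℝ)) :=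
  I.prod 𝓘(ℝ, E →L[ℝ] ℝ)

variable (I : ModelWithCorners ℝ E H) (M : Type*) [TopologicalSpace M]
    [ChartedSpace H M] [IsManifold I 1 M]

/-- The canonical 1-form `θ` on the cotangent bundle, `θ_α (w) = α (Tπ w)`. -/
def canonicalOneForm : DiffForm (cotangentModel I) (Cotangent I M) 1 :=
  fun α => ContinuousAlternatingMap.ofSubsingleton ℝ _ ℝ (0 : Fin 1)
    ((α.snd : TangentSpace I α.proj →L[ℝ] ℝ).comp
      (mfderiv (cotangentModel I) I (fun z : Cotangent I M => z.proj) α))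

/-- The canonical symplectic form `ω = -dθ` on the cotangent bundle. -/
def canonicalTwoForm : DiffForm (cotangentModel I) (Cotangent I M) 2 :=
  fun α => -((canonicalOneForm I M).d α)

end Cotangent

section TangentSet

variable {E : Type*} [NormedAddCommGroup E] [NormedSpace ℝ E]
  {H : Type*} [TopologicalSpace H]

/-- The tangent bundle `TA ⊆ TM` of a subset `A ⊆ M`: all velocities of smooth curves of `M` that
stay in `A`. For an embedded submanifold this is its tangent bundle. -/
def tangentSet (I : ModelWithCorners ℝ E H) {M : Type*} [TopologicalSpace M] [ChartedSpace H M]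
    (A : Set M) : Set (TangentBundle I M) :=
  {v | ∃ γ : ℝ → M, ContMDiff 𝓘(ℝ, ℝ) I ∞ γ ∧ (∀ t, γ t ∈ A) ∧
    tangentMap 𝓘(ℝ, ℝ) I γ ⟨0, (1 : ℝ)⟩ = v}

end TangentSet

section OCP

/-- An optimal control problem on the manifold `Q` of dimension `n` with `m` real controls: the set
`U` of admissible controls, the vector field `X` depending on the controls, and the running cost
`F`. Both are smooth at the controls in the interior of `U`. -/
structure OptimalControlProblem (n m : ℕ) (Q : Type*) [TopologicalSpace Q]
    [ChartedSpace (EuclideanSpace ℝ (Fin n)) Q] [IsManifold (𝓡 n) ∞ Q] where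
  U : Set (EuclideanSpace ℝ (Fin m))
  X : ∀ q : Q, EuclideanSpace ℝ (Fin m) → TangentSpace (𝓡 n) q
  F : Q → EuclideanSpace ℝ (Fin m) → ℝ
  smooth_X : ContMDiffOn ((𝓡 n).prod (𝓡 m)) (𝓡 n).tangent ∞
    (fun z : Q × EuclideanSpace ℝ (Fin m) => (⟨z.1, X z.1 z.2⟩ : TangentBundle (𝓡 n) Q))
    (univ ×ˢ interior U)
  smooth_F : ContMDiffOn ((𝓡 n).prod (𝓡 m)) 𝓘(ℝ, ℝ) ∞
    (fun z : Q × EuclideanSpace ℝ (Fin m) => F z.1 z.2) (univ ×ˢ interior U)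

namespace OptimalControlProblem

variable {n m : ℕ} {Q : Type*} [TopologicalSpace Q]
    [ChartedSpace (EuclideanSpace ℝ (Fin n)) Q] [IsManifold (𝓡 n) ∞ Q]
    (P : OptimalControlProblem n m Q)

/-- Pontryagin's Hamiltonian `H(q, p, u) = ⟨p, X(q, u)⟩ - F(q, u)` on `T^*Q × U`. -/
def hamiltonian (α : Cotangent (𝓡 n) Q) (u : EuclideanSpace ℝ (Fin m)) : ℝ :=
  (α.snd : TangentSpace (𝓡 n) α.proj →L[ℝ] ℝ) (P.X α.proj u) - P.F α.proj u

/-- The derivative `∂H/∂u` of the Hamiltonian in the controls. -/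
def dHdu (z : Cotangent (𝓡 n) Q × EuclideanSpace ℝ (Fin m)) :
    EuclideanSpace ℝ (Fin m) →L[ℝ] ℝ :=
  fderiv ℝ (fun u => P.hamiltonian z.1 u) z.2

/-- The Hamiltonian is a Morse family over `T^*Q × U → T^*Q`: at the points of `T^*Q × int U`
where `∂H/∂u = 0`, the matrix `D_{(q,p,u)} (∂H/∂u)` has maximal rank. -/
def IsMorseFamily : Prop :=
  ∀ (α : Cotangent (𝓡 n) Q), ∀ u ∈ interior P.U, P.dHdu (α, u) = 0 →
    Function.Surjective
      (mfderiv ((cotangentModel (𝓡 n)).prod (𝓡 m))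
        𝓘(ℝ, EuclideanSpace ℝ (Fin m) →L[ℝ] ℝ) P.dHdu (α, u))

/-- The subset `L_H` of `T^*T^*Q`: the covectors `d_α H(·, u)` at points `α` for which the
interior control `u` satisfies `∂H/∂u (α, u) = 0`. -/
def lagrangianSet : Set (Cotangent (cotangentModel (𝓡 n)) (Cotangent (𝓡 n) Q)) :=
  {ξ | ∃ u ∈ interior P.U, P.dHdu (ξ.proj, u) = 0 ∧
    (ξ.snd : TangentSpace (cotangentModel (𝓡 n)) ξ.proj →L[ℝ] ℝ) =
      mfderiv (cotangentModel (𝓡 n)) 𝓘(ℝ, ℝ) (fun α => P.hamiltonian α u) ξ.proj}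

/-- The dynamics `S_H = {v ∈ TT^*Q | i_v ω ∈ L_H}`. -/
def dynamics : Set (TangentBundle (cotangentModel (𝓡 n)) (Cotangent (𝓡 n) Q)) :=
  {v | (⟨v.proj, (ContinuousAlternatingMap.ofSubsingleton ℝ
      (TangentSpace (cotangentModel (𝓡 n)) v.proj) ℝ (0 : Fin 1)).symm
        (contract (canonicalTwoForm (𝓡 n) Q v.proj) v.snd)⟩ :
      Cotangent (cotangentModel (𝓡 n)) (Cotangent (𝓡 n) Q)) ∈ P.lagrangianSet}

/-- The sets `S_H^k` of the integrability algorithm: `S_H^0 = S_H` and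
`S_H^{k+1} = T P_H^k ∩ S_H^k`, where `P_H^k = τ (S_H^k)`. -/
def algS : ℕ → Set (TangentBundle (cotangentModel (𝓡 n)) (Cotangent (𝓡 n) Q))
  | 0 => P.dynamics
  | k + 1 => tangentSet (cotangentModel (𝓡 n)) ((fun v => v.proj) '' algS k) ∩ algS k

/-- The sets `P_H^k = τ (S_H^k)` of the integrability algorithm. -/
def algP (k : ℕ) : Set (Cotangent (𝓡 n) Q) :=
  (fun v => v.proj) '' P.algS k

end OptimalControlProblem

end OCP

end PresymplecticOCP

end

/-! Since ω and ω_f are closed, their complete lifts are d(i_T ω) and d(i_T ω_f); smoothness and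
closedness of all the forms then follow from the calculus of d, pullback and i_T. Stabilization says
that every vector of S_H^f is the velocity of a curve in P_H^f, so `j` factors as Ti ∘ `jf`. Because
`i` is an embedding, `jf` is again a smooth embedding (`isSmoothEmbedding_of_tangentMap_comp`).

Isotropy. By naturality of i_T (`DiffForm.pullback_iT`), jf^* i_T ω_f = j^* i_T ω. At s this
one-form is dH(·,u) composed with T(τ ∘ j), where u is a control attached to j(s). As ∂H/∂u = 0, it
is the differential of s ↦ H(τ(j(s)), u(s)), hence closed, provided u varies in a Lipschitz way. The
controls are only given pointwise, with no continuity. The Morse condition makes (α, u) ↦ (α, DH(α,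
u)) expanding near each critical point, which controls u as long as it stays in a small ball. A
Baire category argument finds, inside every nonempty open set, a smaller one over which the controls
can be taken in a single such ball. So the exterior derivative vanishes on a dense set, and
everywhere by continuity (`extDeriv_eq_zero_of_morse`).

Dimension. Contracting d_T η with a vertical vector (0, b) gives the pullback of i_b η from the base
(`dT_apply_vertical`). Let L be a tangent space of S_H^f and K the kernel of the form. L is
isotropic and, by the submersion hypothesis, projects onto the tangent space of P_H^f. A vector
orthogonal to L differs from an element of L by a vertical vector, and a vertical vector orthogonal
to L lies in K. Hence the orthogonal of L is L + K, and counting dimensions gives the Lagrangian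
formula (`finrank_isotropic_of_surjective_fst`). -/

noncomputable section

namespace PresymplecticOCP

open Filter Function

/-! ### Smoothness of alternating-map operations and an expansion estimate -/

section Analysis

/-- Alternatization divided by the factorial of the number of arguments is a continuous linear left
inverse of the inclusion of alternating maps into multilinear maps, so smoothness can be tested
after the inclusion. -/
theorem _root_.ContinuousAlternatingMap.contDiff_toContinuousMultilinearMap_comp_iff
    {X E F ι : Type*} [Fintype ι] [NormedAddCommGroup X] [NormedSpace ℝ X]
    [NormedAddCommGroup E] [NormedSpace ℝ E] [NormedAddCommGroup F] [NormedSpace ℝ F]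
    {n : ℕ∞ω} {f : X → E [⋀^ι]→L[ℝ] F} :
    ContDiff ℝ n (fun x => (f x).toContinuousMultilinearMap) ↔ ContDiff ℝ n f := by
  classical
  refine ⟨fun h => ?_, fun h =>
    (ContinuousAlternatingMap.toContinuousMultilinearMapCLM ℝ : (E [⋀^ι]→L[ℝ] F) →L[ℝ]
      ContinuousMultilinearMap ℝ (fun _ : ι => E) F).contDiff.comp h⟩
  have hcont : Continuous
      (ContinuousMultilinearMap.alternatization (R := ℝ) (M := E) (N := F) (ι := ι)) := by
    rw [ContinuousAlternatingMap.isEmbedding_toContinuousMultilinearMap.continuous_iff]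
    have : (ContinuousAlternatingMap.toContinuousMultilinearMap ∘
        (ContinuousMultilinearMap.alternatization (R := ℝ) (M := E) (N := F) (ι := ι))) =
        fun f => ∑ σ : Equiv.Perm ι, ((Equiv.Perm.sign σ : ℤ) : ℝ) •
          ContinuousMultilinearMap.domDomCongrₗᵢ ℝ E F σ f := by
      ext f v
      simp [ContinuousMultilinearMap.alternatization_apply_apply,
        Units.smul_def, Function.comp_def]
      exact Finset.sum_congr rfl fun σ _ => by
        rcases Int.units_eq_one_or (Equiv.Perm.sign σ) with h | h <;> simp [h] <;> rfl
    rw [this]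
    fun_prop
  have key : f = fun x => ((Nat.factorial (Fintype.card ι) : ℝ)⁻¹ •
      (ContinuousMultilinearMap.alternatization.toRealLinearMap hcont))
        ((f x).toContinuousMultilinearMap) := by
    ext x v
    have h2 := AlternatingMap.coe_alternatization (f x).toAlternatingMap
    have h3 := DFunLike.congr_fun h2 v
    have h4 : ContinuousMultilinearMap.alternatization (f x).toContinuousMultilinearMap v =
      (Nat.factorial (Fintype.card ι)) • (f x v) := by
      simpa [ContinuousMultilinearMap.alternatization_apply_apply,
        MultilinearMap.alternatization_apply, Function.comp_def] using h3
    have h5 : ((Nat.factorial (Fintype.card ι) : ℝ)) ≠ 0 := by positivity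
    change f x v = (Nat.factorial (Fintype.card ι) : ℝ)⁻¹ •
      ContinuousMultilinearMap.alternatization (f x).toContinuousMultilinearMap v
    rw [h4, ← Nat.cast_smul_eq_nsmul ℝ, smul_smul, inv_mul_cancel₀ h5, one_smul]
  rw [key]
  exact (ContinuousLinearMap.contDiff _).comp h

theorem _root_.ContinuousAlternatingMap.contDiff_compContinuousLinearMap
    {E F G ι : Type*} [Fintype ι]
    [NormedAddCommGroup E] [NormedSpace ℝ E] [NormedAddCommGroup F] [NormedSpace ℝ F]
    [NormedAddCommGroup G] [NormedSpace ℝ G] [CompleteSpace G] {n : ℕ∞ω} :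
    ContDiff ℝ n (fun p : (F [⋀^ι]→L[ℝ] G) × (E →L[ℝ] F) => p.1.compContinuousLinearMap p.2) := by
  rw [← ContinuousAlternatingMap.contDiff_toContinuousMultilinearMap_comp_iff]
  have h1 : ContDiff ℝ n (fun p : (ι → E →L[ℝ] F) ×
      (ContinuousMultilinearMap ℝ (fun _ : ι => F) G) => p.2.compContinuousLinearMap p.1) := by
    rw [contDiff_iff_contDiffAt]
    intro q
    exact (ContinuousMultilinearMap.analyticAt_uncurry_compContinuousLinearMap (q := q)).contDiffAt
  have h2 : ContDiff ℝ n (fun p : (F [⋀^ι]→L[ℝ] G) × (E →L[ℝ] F) =>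
      ((fun _ : ι => p.2), p.1.toContinuousMultilinearMap)) :=
    (contDiff_pi.2 fun _ => contDiff_snd).prodMk
      ((ContinuousAlternatingMap.toContinuousMultilinearMapCLM ℝ : (F [⋀^ι]→L[ℝ] G) →L[ℝ]
        ContinuousMultilinearMap ℝ (fun _ : ι => F) G).contDiff.comp contDiff_fst)
  exact h1.comp h2

/-- A map with injective strict derivative is expanding near the point. -/
theorem _root_.HasStrictFDerivAt.exists_nhds_le_norm_sub
    {E F : Type*} [NormedAddCommGroup E] [NormedSpace ℝ E] [FiniteDimensional ℝ E]
    [NormedAddCommGroup F] [NormedSpace ℝ F] {g : E → F} {g' : E →L[ℝ] F} {z : E}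
    (hg : HasStrictFDerivAt g g' z) (hinj : Injective g') :
    ∃ C : ℝ, ∃ N ∈ 𝓝 z, ∀ a ∈ N, ∀ b ∈ N, ‖a - b‖ ≤ C * ‖g a - g b‖ := by
  obtain ⟨K, hK, hanti⟩ := (g' : E →ₗ[ℝ] F).exists_antilipschitzWith
    (LinearMap.ker_eq_bot.2 hinj)
  have hK' : (0 : ℝ) < K := by exact_mod_cast hK
  -- `g'` expands by at least 1/K. An error of half that size costs half of ‖a - b‖, which is
  -- absorbed on the left and leaves the constant 2K.
  have h1 := hg.isLittleO.def (c := (2 * (K : ℝ))⁻¹) (by positivity)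
  rw [nhds_prod_eq, eventually_prod_self_iff'] at h1
  obtain ⟨N, hN, h2⟩ := h1
  refine ⟨2 * K, N, hN, fun a ha b hb => ?_⟩
  have h3 := h2 a ha b hb
  have h4 := hanti.le_mul_dist (a - b) 0
  simp only [dist_eq_norm, map_zero, sub_zero] at h4
  have h4' : ‖a - b‖ ≤ K * ‖g' (a - b)‖ := h4
  have h5 : ‖g' (a - b)‖ ≤ ‖g a - g b‖ + (2 * (K : ℝ))⁻¹ * ‖a - b‖ := by
    calc ‖g' (a - b)‖ = ‖(g a - g b) - (g a - g b - g' (a - b))‖ := by congr 1; abel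
      _ ≤ _ := (norm_sub_le _ _).trans (by gcongr)
  have h6 : ‖a - b‖ ≤ K * ‖g a - g b‖ + (1 / 2) * ‖a - b‖ := by
    refine h4'.trans ((mul_le_mul_of_nonneg_left h5 hK'.le).trans (le_of_eq ?_))
    field_simp
  linarith

end Analysis

/-! ### Isotropy of the set generated by a Morse family -/

section GeneratingFamily

/-- If a one-form has a primitive near a point then its exterior derivative vanishes there. -/
theorem extDeriv_eq_zero_of_eventually_hasFDerivAt
    {X : Type*} [NormedAddCommGroup X] [NormedSpace ℝ X]
    {ζ : X → X [⋀^Fin 1]→L[ℝ] ℝ} {β : X → X →L[ℝ] ℝ} {f : X → ℝ} {y : X}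
    (hζ : ContDiffAt ℝ 1 ζ y)
    (hβ : ∀ᶠ z in 𝓝 y, ζ z = ContinuousAlternatingMap.ofSubsingleton ℝ X ℝ (0 : Fin 1) (β z))
    (hf : ∀ᶠ z in 𝓝 y, HasFDerivAt f (β z) z) : extDeriv ζ y = 0 := by
  have hβ' : ContDiffAt ℝ 1 β y := by
    have h1 : ContDiffAt ℝ 1
        (fun z => (ContinuousAlternatingMap.ofSubsingletonLIE (𝕜 := ℝ) (E := X) (F := ℝ) (0 : Fin 1)).symm (ζ z)) y :=
      (ContinuousAlternatingMap.ofSubsingletonLIE (𝕜 := ℝ) (E := X) (F := ℝ)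
        (0 : Fin 1)).symm.contDiff.contDiffAt.comp y hζ
    refine h1.congr_of_eventuallyEq (hβ.mono fun z hz => ?_)
    simp only [hz]
    exact ((ContinuousAlternatingMap.ofSubsingletonLIE (𝕜 := ℝ) (E := X) (F := ℝ) (0 : Fin 1)).symm_apply_apply _).symm
  -- The derivative of `f` is the C¹ field `β`, so `f` is C² and d(df) = 0 applies.
  have hf2 : ContDiffAt ℝ 2 f y := by
    rw [show (2 : ℕ∞ω) = ((1 : ℕ) : ℕ∞ω) + 1 by norm_num, contDiffAt_succ_iff_hasFDerivAt]
    exact ⟨β, ⟨_, hf, fun z hz => hz⟩, by exact_mod_cast hβ'⟩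
  have h3 : ζ =ᶠ[𝓝 y] extDeriv
      (fun x => ContinuousAlternatingMap.constOfIsEmpty ℝ X (Fin 0) (f x)) := by
    filter_upwards [hβ, hf] with z hz hz'
    rw [hz, extDeriv_constOfIsEmpty, hz'.fderiv]
  rw [h3.extDeriv_eq]
  refine extDeriv_extDeriv_apply (r := 2) ?_ (by simp)
  exact (ContinuousAlternatingMap.constOfIsEmptyLIE ℝ X ℝ (Fin 0)).contDiff.contDiffAt.comp y hf2

variable {X F U : Type*} [NormedAddCommGroup X] [NormedSpace ℝ X] [FiniteDimensional ℝ X]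
  [NormedAddCommGroup F] [NormedSpace ℝ F] [FiniteDimensional ℝ F]
  [NormedAddCommGroup U] [NormedSpace ℝ U] [FiniteDimensional ℝ U]

/-- At a critical point of a Morse family `h`, the map `(a, u) ↦ (a, Dh (a, u))` is locally
expanding. -/
theorem exists_nhds_le_norm_sub_of_morse {h : F × U → ℝ} {z : F × U}
    (hh : ContDiffAt ℝ ∞ h z)
    (hmorse : Surjective (fderiv ℝ (fun z => (fderiv ℝ h z).comp (.inr ℝ F U)) z)) :
    ∃ C : ℝ, ∃ N ∈ 𝓝 z, ∀ a ∈ N, ∀ b ∈ N,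
      ‖a - b‖ ≤ C * ‖(a.1, fderiv ℝ h a) - (b.1, fderiv ℝ h b)‖ := by
  have h1 : ContDiffAt ℝ 1 (fderiv ℝ h) z := hh.fderiv_right (m := 1) (by norm_cast)
  have hd : HasFDerivAt (fderiv ℝ h) (fderiv ℝ (fderiv ℝ h) z) z :=
    (h1.differentiableAt one_ne_zero).hasFDerivAt
  have hs := hasStrictFDerivAt_fst.prodMk (h1.hasStrictFDerivAt one_ne_zero)
    (𝕜 := ℝ) (f₁ := (Prod.fst : F × U → F))
  refine hs.exists_nhds_le_norm_sub ((injective_iff_map_eq_zero _).2 fun w hw => ?_)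
  have hw1 : w.1 = 0 := congrArg Prod.fst hw
  have hw2 : fderiv ℝ (fderiv ℝ h) z w = 0 := congrArg Prod.snd hw
  have hsymm : IsSymmSndFDerivAt ℝ h z :=
    hh.isSymmSndFDerivAt (by rw [minSmoothness_of_isRCLikeNormedField]; exact WithTop.coe_le_coe.2 le_top)
  have h3 : fderiv ℝ (fun z => (fderiv ℝ h z).comp (.inr ℝ F U)) z =
      ((ContinuousLinearMap.compL ℝ U (F × U) ℝ).flip (.inr ℝ F U)).comp
        (fderiv ℝ (fderiv ℝ h) z) :=
    (((ContinuousLinearMap.compL ℝ U (F × U) ℝ).flip (.inr ℝ F U)).hasFDerivAt.comp z hd).fderiv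
  -- A kernel vector is w = (0, w.2) with D²h(w, ·) = 0. By symmetry D²h(v, ·) kills (0, w.2) for
  -- every v, and by the Morse condition the restrictions of D²h(v, ·) to `U` are all the
  -- functionals.
  have h4 : ∀ p : U →L[ℝ] ℝ, p w.2 = 0 := by
    intro p
    obtain ⟨v, hv⟩ := hmorse p
    rw [h3] at hv
    rw [← hv]
    have h5 := hsymm v w
    rw [hw2] at h5
    have h6 : (0, w.2) = w := Prod.ext hw1.symm rfl
    simpa [h6] using h5
  have hw3 : w.2 = 0 := by
    by_contra hne
    obtain ⟨p, -, hp⟩ := exists_dual_vector ℝ w.2 (norm_ne_zero_iff.2 hne)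
    rw [h4 p] at hp
    exact hne (norm_eq_zero.1 (by simpa using hp.symm))
  exact Prod.ext hw1 hw3

/-- The Lagrangian set generated by a Morse family is isotropic: a one-form `⟨Ξ, dA⟩` obtained from
maps `A`, `Ξ` taking values in that set is closed. -/
theorem extDeriv_eq_zero_of_morse {h : F × U → ℝ} {O : Set (F × U)} (hO : IsOpen O)
    (hh : ContDiffOn ℝ ∞ h O)
    (hmorse : ∀ z ∈ O, (fderiv ℝ h z).comp (.inr ℝ F U) = 0 →
      Surjective (fderiv ℝ (fun z => (fderiv ℝ h z).comp (.inr ℝ F U)) z))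
    {B : Set X} (hB : IsOpen B) {A : X → F} {Ξ : X → F →L[ℝ] ℝ}
    (hA : ContDiffOn ℝ ∞ A B) (hΞ : ContDiffOn ℝ ∞ Ξ B)
    (hex : ∀ y ∈ B, ∃ u, (A y, u) ∈ O ∧ fderiv ℝ h (A y, u) = (Ξ y).comp (.fst ℝ F U))
    {ζ : X → X [⋀^Fin 1]→L[ℝ] ℝ} (hζ : ContDiffOn ℝ ∞ ζ B)
    (hζB : ∀ y ∈ B, ζ y =
      ContinuousAlternatingMap.ofSubsingleton ℝ X ℝ (0 : Fin 1) ((Ξ y).comp (fderiv ℝ A y))) :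
    ∀ y ∈ B, extDeriv ζ y = 0 := by
  have hBn : ∀ y ∈ B, B ∈ 𝓝 y := fun y hy => hB.mem_nhds hy
  have hdζ : ContinuousOn (extDeriv ζ) B := by
    have h1 := hζ.continuousOn_fderiv_of_isOpen hB (by norm_cast)
    exact (ContinuousAlternatingMap.alternatizeUncurryFinCLM ℝ X ℝ).continuous.comp_continuousOn h1
  have hdh : ContinuousOn (fderiv ℝ h) O := hh.continuousOn_fderiv_of_isOpen hO (by norm_cast)
  by_contra! hne
  obtain ⟨y₀, hy₀, hne₀⟩ := hne
  -- If the claim fails, this open set is nonempty; a point of it with a local primitive of `ζ`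
  -- gives the contradiction.
  set W : Set X := B ∩ extDeriv ζ ⁻¹' {0}ᶜ with hWdef
  have hW : IsOpen W := hdζ.isOpen_inter_preimage hB isOpen_compl_singleton
  -- The balls are closed, hence compact, so that limits of controls stay inside them; countably
  -- many of them cover the critical set.
  have hcov : ∀ z ∈ {z ∈ O | (fderiv ℝ h z).comp (.inr ℝ F U) = 0}, ∃ C ε : ℝ, 0 < ε ∧
      Metric.closedBall z ε ⊆ O ∧ ∀ a ∈ Metric.closedBall z ε, ∀ b ∈ Metric.closedBall z ε,
        ‖a - b‖ ≤ C * ‖(a.1, fderiv ℝ h a) - (b.1, fderiv ℝ h b)‖ := by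
    intro z hz
    obtain ⟨C, N, hN, hCN⟩ := exists_nhds_le_norm_sub_of_morse
      (hh.contDiffAt (hO.mem_nhds hz.1)) (hmorse z hz.1 hz.2)
    obtain ⟨ε, hε, hεN⟩ := Metric.nhds_basis_closedBall.mem_iff.1
      (inter_mem hN (hO.mem_nhds hz.1))
    exact ⟨C, ε, hε, fun a ha => (hεN ha).2, fun a ha b hb => hCN a (hεN ha).1 b (hεN hb).1⟩
  choose! C ε hε hεO hC using hcov
  obtain ⟨t, htS, htc, ht⟩ := TopologicalSpace.countable_cover_nhdsWithin
    (f := fun z => Metric.closedBall z (ε z)) (s := {z ∈ O | (fderiv ℝ h z).comp (.inr ℝ F U) = 0})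
    (fun z hz => nhdsWithin_le_nhds (Metric.closedBall_mem_nhds z (hε z hz)))
  -- `T z w`: some admissible control over `w` lies in the ball around `z`. These sets of `w` are
  -- closed by compactness of the ball and cover `W` by `hex`.
  let T : F × U → X → Prop := fun z w => ∃ u, (A w, u) ∈ Metric.closedBall z (ε z) ∧
    fderiv ℝ h (A w, u) = (Ξ w).comp (.fst ℝ F U)
  have hclosed : ∀ z : t, IsClosed {w : W | T z w} := by
    intro z
    refine IsSeqClosed.isClosed fun w w₀ hw hlim => ?_
    choose u hu hu' using hw
    obtain ⟨a, ha, φ, hφ, hlim'⟩ := (isCompact_closedBall (z : F × U) (ε z)).tendsto_subseq hu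
    have hw₀ : Tendsto (fun k => (w (φ k) : X)) atTop (𝓝 (w₀ : X)) :=
      (continuous_subtype_val.tendsto w₀).comp (hlim.comp hφ.tendsto_atTop)
    have hA₀ : Tendsto (fun k => A (w (φ k))) atTop (𝓝 (A w₀)) :=
      (hA.continuousOn.continuousAt (hBn _ w₀.2.1)).tendsto.comp hw₀
    have hΞ₀ : Tendsto (fun k => (Ξ (w (φ k))).comp (.fst ℝ F U)) atTop
        (𝓝 ((Ξ w₀).comp (.fst ℝ F U))) :=
      (((ContinuousLinearMap.compL ℝ (F × U) F ℝ).flip (.fst ℝ F U)).continuous.tendsto _).comp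
        ((hΞ.continuousOn.continuousAt (hBn _ w₀.2.1)).tendsto.comp hw₀)
    have ha1 : a.1 = A w₀ :=
      tendsto_nhds_unique ((continuous_fst.tendsto a).comp hlim') hA₀
    have hae : a = (A w₀, a.2) := Prod.ext ha1 rfl
    have haO : a ∈ O := hεO z (htS z.2) ha
    have h1 : Tendsto (fun k => fderiv ℝ h (A (w (φ k)), u (φ k))) atTop (𝓝 (fderiv ℝ h a)) :=
      (hdh.continuousAt (hO.mem_nhds haO)).tendsto.comp hlim'
    refine ⟨a.2, hae ▸ ha, ?_⟩
    rw [← hae]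
    refine tendsto_nhds_unique h1 (hΞ₀.congr fun k => (hu' (φ k)).symm)
  have hunion : ⋃ z : t, {w : W | T z w} = univ := by
    refine eq_univ_of_forall fun w => ?_
    obtain ⟨u, huO, hu⟩ := hex w w.2.1
    have h1 : (A w, u) ∈ {z ∈ O | (fderiv ℝ h z).comp (.inr ℝ F U) = 0} := by
      refine ⟨huO, ?_⟩
      rw [hu]
      ext; simp
    obtain ⟨z, hz, hmem⟩ := mem_iUnion₂.1 (ht h1)
    exact mem_iUnion.2 ⟨⟨z, hz⟩, u, hmem, hu⟩
  -- By Baire, one ball serves a whole open subset of `W`, which makes a choice of controls with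
  -- uniform estimates possible there.
  have : BaireSpace W := hW.baireSpace
  have : Nonempty W := ⟨⟨y₀, hy₀, hne₀⟩⟩
  have : Countable t := htc.to_subtype
  obtain ⟨z, w₀, hw₀⟩ := nonempty_interior_of_iUnion_of_closed hclosed hunion
  have hev : ∀ᶠ w in 𝓝 (w₀ : X), w ∈ B ∧ T z w := by
    have h1 : {w : W | T z w} ∈ 𝓝 w₀ := mem_interior_iff_mem_nhds.1 hw₀
    have h2 := (hW.isOpenEmbedding_subtypeVal.image_mem_nhds).2 h1
    filter_upwards [h2, hBn _ w₀.2.1] with w hw hwB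
    obtain ⟨w', hw', rfl⟩ := hw
    exact ⟨hwB, hw'⟩
  choose! u hu hu' using fun w (hw : T z w) => hw
  have hprim : ∀ w, (∀ᶠ w' in 𝓝 w, w' ∈ B ∧ T z w') →
      HasFDerivAt (fun w => h (A w, u w)) ((Ξ w).comp (fderiv ℝ A w)) w := by
    intro w hw
    have hwB := hw.self_of_nhds.1
    have hwT := hw.self_of_nhds.2
    have hAd : HasFDerivAt A (fderiv ℝ A w) w :=
      ((hA.contDiffAt (hBn w hwB)).differentiableAt (by simp)).hasFDerivAt
    have hGd : DifferentiableAt ℝ (fun w => (A w, (Ξ w).comp (.fst ℝ F U))) w :=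
      hAd.differentiableAt.prodMk
        (((ContinuousLinearMap.compL ℝ (F × U) F ℝ).flip (.fst ℝ F U)).differentiableAt.comp w
          ((hΞ.contDiffAt (hBn w hwB)).differentiableAt (by simp)))
    -- The expansion estimate bounds the increment of (A, u) by that of (A, Dh(A, u)). The latter
    -- equals (A, Ξ ∘ fst), which is differentiable, so no regularity of `u` has to be known
    -- beforehand.
    have hbig : (fun w' => (A w', u w') - (A w, u w)) =O[𝓝 w] fun w' => w' - w := by
      refine (Asymptotics.IsBigO.of_bound (C z) ?_).trans hGd.hasFDerivAt.isBigO_sub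
      filter_upwards [hw] with w' hw'
      have := hC z (htS z.2) _ (hu w' hw'.2) _ (hu w hwT)
      rwa [hu' w' hw'.2, hu' w hwT] at this
    have hcont : Tendsto (fun w' => (A w', u w')) (𝓝 w) (𝓝 (A w, u w)) := by
      rw [← tendsto_sub_nhds_zero_iff]
      refine hbig.trans_tendsto ?_
      rw [tendsto_sub_nhds_zero_iff]
      exact tendsto_id
    have hhd : HasFDerivAt h (fderiv ℝ h (A w, u w)) (A w, u w) :=
      ((hh.contDiffAt (hO.mem_nhds (hεO z (htS z.2) (hu w hwT)))).differentiableAt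
        (by simp)).hasFDerivAt
    -- The differential of `h` at these points is Ξ ∘ fst, so the increment of `u` drops out to
    -- first order and differentiability of `u` is not needed.
    have h1 := (hhd.isLittleO.comp_tendsto hcont).trans_isBigO hbig
    have h2 := ((Ξ w).isBigO_comp (fun w' => A w' - A w - fderiv ℝ A w (w' - w)) (𝓝 w)).trans_isLittleO
      hAd.isLittleO
    refine .of_isLittleO ((h1.add h2).congr_left fun w' => ?_)
    simp only [comp_apply, hu' w hwT, ContinuousLinearMap.comp_apply, map_sub,
      ContinuousLinearMap.coe_fst']
    ring
  refine w₀.2.2 (extDeriv_eq_zero_of_eventually_hasFDerivAt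
    ((hζ.contDiffAt (hBn _ w₀.2.1)).of_le (by norm_cast)) ?_ (hev.eventually_nhds.mono hprim))
  filter_upwards [hBn _ w₀.2.1] with w hw using hζB w hw

end GeneratingFamily

/-! ### Pullback and exterior derivative on manifolds -/

section FormCalculus

variable {E : Type*} [NormedAddCommGroup E] [NormedSpace ℝ E]
  {H : Type*} [TopologicalSpace H] {I : ModelWithCorners ℝ E H}
  {M : Type*} [TopologicalSpace M] [ChartedSpace H M]
  {E' : Type*} [NormedAddCommGroup E'] [NormedSpace ℝ E']
  {H' : Type*} [TopologicalSpace H'] {I' : ModelWithCorners ℝ E' H'}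
  {M' : Type*} [TopologicalSpace M'] [ChartedSpace H' M']
  {E'' : Type*} [NormedAddCommGroup E''] [NormedSpace ℝ E'']
  {H'' : Type*} [TopologicalSpace H''] {I'' : ModelWithCorners ℝ E'' H''}
  {M'' : Type*} [TopologicalSpace M''] [ChartedSpace H'' M''] {k : ℕ}

theorem DiffForm.pullback_congr {f g : M' → M} {x : M'} (η : DiffForm I M k) (h : f =ᶠ[𝓝 x] g) :
    DiffForm.pullback (I' := I') f η x = DiffForm.pullback (I' := I') g η x := by
  have h1 : (mfderiv I' I f x : E' →L[ℝ] E) = mfderiv I' I g x := h.mfderiv_eq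
  have h2 : f x = g x := h.self_of_nhds
  let η' : M → E [⋀^Fin k]→L[ℝ] ℝ := η
  change (η' (f x)).compContinuousLinearMap (mfderiv I' I f x : E' →L[ℝ] E) =
    (η' (g x)).compContinuousLinearMap (mfderiv I' I g x : E' →L[ℝ] E)
  rw [h1, h2]

theorem DiffForm.pullback_comp {f : M' → M} {g : M'' → M'} {x : M''} (η : DiffForm I M k)
    (hf : MDifferentiableAt I' I f (g x)) (hg : MDifferentiableAt I'' I' g x) :
    DiffForm.pullback (I' := I'') (f ∘ g) η x =
      (DiffForm.pullback (I' := I') f η (g x)).compContinuousLinearMap (mfderiv I'' I' g x) := by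
  rw [DiffForm.pullback, mfderiv_comp x hf hg]
  rfl

theorem DiffForm.inChart_eq_pullback [I.Boundaryless] (η : DiffForm I M k) (x₀ : M) :
    η.inChart x₀ = DiffForm.pullback (I' := 𝓘(ℝ, E)) (extChartAt I x₀).symm η := by
  funext y
  rw [DiffForm.inChart, DiffForm.pullback, I.range_eq_univ, mfderivWithin_univ]
  rfl

theorem extChartAt_target_mem_nhds_of_mem [I.Boundaryless] {x₀ : M} {y : E}
    (hy : y ∈ (extChartAt I x₀).target) : (extChartAt I x₀).target ∈ 𝓝 y :=
  (isOpen_extChartAt_target x₀).mem_nhds hy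

theorem contMDiffAt_extChartAt_symm [I.Boundaryless] {n : ℕ∞ω} [IsManifold I n M] {x₀ : M} {y : E}
    (hy : y ∈ (extChartAt I x₀).target) :
    ContMDiffAt 𝓘(ℝ, E) I n (extChartAt I x₀).symm y :=
  (contMDiffOn_extChartAt_symm x₀).contMDiffAt (extChartAt_target_mem_nhds_of_mem hy)

/-- The coordinate expression of a pullback. -/
theorem DiffForm.inChart_pullback [I.Boundaryless] [I'.Boundaryless] [IsManifold I 1 M]
    [IsManifold I' 1 M'] {f : M' → M} (η : DiffForm I M k) {x₀ : M'} {z₀ : M} {y : E'}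
    (hy : y ∈ (extChartAt I' x₀).target)
    (hf : MDifferentiableAt I' I f ((extChartAt I' x₀).symm y))
    (hz : f ((extChartAt I' x₀).symm y) ∈ (extChartAt I z₀).source) :
    (DiffForm.pullback (I' := I') f η).inChart x₀ y =
      (η.inChart z₀ ((extChartAt I z₀ ∘ f ∘ (extChartAt I' x₀).symm) y)).compContinuousLinearMap
        (fderiv ℝ (extChartAt I z₀ ∘ f ∘ (extChartAt I' x₀).symm) y) := by
  have hφ : MDifferentiableAt 𝓘(ℝ, E') I' (extChartAt I' x₀).symm y :=
    (contMDiffAt_extChartAt_symm hy).mdifferentiableAt one_ne_zero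
  have hfφ : MDifferentiableAt 𝓘(ℝ, E') I (f ∘ (extChartAt I' x₀).symm) y := hf.comp y hφ
  have hF : MDifferentiableAt 𝓘(ℝ, E') 𝓘(ℝ, E) (extChartAt I z₀ ∘ f ∘ (extChartAt I' x₀).symm) y :=
    (mdifferentiableAt_extChartAt (by rwa [extChartAt_source] at hz)).comp y hfφ
  have hψ : MDifferentiableAt 𝓘(ℝ, E) I (extChartAt I z₀).symm
      ((extChartAt I z₀ ∘ f ∘ (extChartAt I' x₀).symm) y) :=
    (contMDiffAt_extChartAt_symm ((extChartAt I z₀).map_source hz)).mdifferentiableAt one_ne_zero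
  rw [DiffForm.inChart_eq_pullback, DiffForm.inChart_eq_pullback]
  rw [← mfderiv_eq_fderiv]
  refine (DiffForm.pullback_comp η hf hφ).symm.trans (.trans ?_ (DiffForm.pullback_comp η hψ hF))
  refine DiffForm.pullback_congr η ?_
  filter_upwards [hfφ.continuousAt.preimage_mem_nhds
    ((isOpen_extChartAt_source z₀).mem_nhds hz)] with w hw
  exact ((extChartAt I z₀).left_inv hw).symm

theorem DiffForm.d_eq [I.Boundaryless] (η : DiffForm I M k) (x : M) :
    η.d x = extDeriv (η.inChart x) (extChartAt I x x) := by
  rw [DiffForm.d, I.range_eq_univ, extDerivWithin_univ]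

theorem DiffForm.IsSmooth.contDiffAt [I.Boundaryless] {η : DiffForm I M k} (hη : η.IsSmooth)
    {x₀ : M} {y : E} (hy : y ∈ (extChartAt I x₀).target) : ContDiffAt ℝ ∞ (η.inChart x₀) y :=
  (hη x₀).contDiffAt (extChartAt_target_mem_nhds_of_mem hy)

theorem writtenInCharts_contDiffAt [I.Boundaryless] [I'.Boundaryless] [IsManifold I ∞ M]
    [IsManifold I' ∞ M'] {f : M' → M} {x₀ : M'} {z₀ : M} {y : E'}
    (hy : y ∈ (extChartAt I' x₀).target)
    (hf : ContMDiffAt I' I ∞ f ((extChartAt I' x₀).symm y))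
    (hz : f ((extChartAt I' x₀).symm y) ∈ (extChartAt I z₀).source) :
    ContDiffAt ℝ ∞ (extChartAt I z₀ ∘ f ∘ (extChartAt I' x₀).symm) y := by
  rw [← contMDiffAt_iff_contDiffAt]
  exact (contMDiffAt_extChartAt' (by rwa [extChartAt_source] at hz)).comp y
    (hf.comp y (contMDiffAt_extChartAt_symm hy))

theorem DiffForm.IsSmooth.pullback [I.Boundaryless] [I'.Boundaryless] [IsManifold I ∞ M]
    [IsManifold I' ∞ M'] {η : DiffForm I M k} (hη : η.IsSmooth) {f : M' → M}
    (hf : ContMDiff I' I ∞ f) : (DiffForm.pullback (I' := I') f η).IsSmooth := by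
  intro x₀ y hy
  set z₀ := f ((extChartAt I' x₀).symm y) with hz₀
  have hz : f ((extChartAt I' x₀).symm y) ∈ (extChartAt I z₀).source := mem_extChartAt_source _
  have hF := writtenInCharts_contDiffAt hy hf.contMDiffAt hz
  have h1 : ContDiffAt ℝ ∞ (fun w => (η.inChart z₀
      ((extChartAt I z₀ ∘ f ∘ (extChartAt I' x₀).symm) w)).compContinuousLinearMap
        (fderiv ℝ (extChartAt I z₀ ∘ f ∘ (extChartAt I' x₀).symm) w)) y :=
    ContDiffAt.comp y (g := fun p : (E [⋀^Fin k]→L[ℝ] ℝ) × (E' →L[ℝ] E) =>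
        p.1.compContinuousLinearMap p.2)
      ContinuousAlternatingMap.contDiff_compContinuousLinearMap.contDiffAt
      ((ContDiffAt.comp y (g := η.inChart z₀) (hη.contDiffAt ((extChartAt I z₀).map_source hz)) hF).prodMk
        (hF.fderiv_right (m := ∞) (by simp)))
  refine (h1.congr_of_eventuallyEq ?_).contDiffWithinAt
  have hc : ContinuousAt (f ∘ (extChartAt I' x₀).symm) y :=
    hf.continuous.continuousAt.comp (continuousAt_extChartAt_symm'' hy)
  filter_upwards [extChartAt_target_mem_nhds_of_mem hy,
    hc.preimage_mem_nhds ((isOpen_extChartAt_source z₀).mem_nhds hz)] with w hw hw'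
  exact DiffForm.inChart_pullback η hw (hf.mdifferentiableAt (by simp)) hw'

/-- The exterior derivative commutes with pullbacks. -/
theorem DiffForm.d_pullback [I.Boundaryless] [I'.Boundaryless] [IsManifold I ∞ M]
    [IsManifold I' ∞ M'] {η : DiffForm I M k} (hη : η.IsSmooth) {f : M' → M} {x : M'}
    (hf : ContMDiffAt I' I ∞ f x) :
    (DiffForm.pullback (I' := I') f η).d x = DiffForm.pullback (I' := I') f η.d x := by
  have hx := mem_extChartAt_target (I := I') x
  have hx' : ContMDiffAt I' I ∞ f ((extChartAt I' x).symm (extChartAt I' x x)) := by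
    rwa [extChartAt_to_inv]
  have hz : f ((extChartAt I' x).symm (extChartAt I' x x)) ∈ (extChartAt I (f x)).source := by
    rw [extChartAt_to_inv]
    exact mem_extChartAt_source _
  have hF := writtenInCharts_contDiffAt hx hx' hz
  have h0 : (extChartAt I (f x) ∘ f ∘ (extChartAt I' x).symm) (extChartAt I' x x) =
      extChartAt I (f x) (f x) := by
    simp only [comp_apply, extChartAt_to_inv]
  have hη' : DifferentiableAt ℝ (η.inChart (f x))
      ((extChartAt I (f x) ∘ f ∘ (extChartAt I' x).symm) (extChartAt I' x x)) := by
    rw [h0]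
    exact (hη.contDiffAt (mem_extChartAt_target _)).differentiableAt (by simp)
  have hev : (DiffForm.pullback (I' := I') f η).inChart x =ᶠ[𝓝 (extChartAt I' x x)] fun w =>
      (η.inChart (f x) ((extChartAt I (f x) ∘ f ∘ (extChartAt I' x).symm) w)).compContinuousLinearMap
        (fderiv ℝ (extChartAt I (f x) ∘ f ∘ (extChartAt I' x).symm) w) := by
    have hfev : ∀ᶠ z in 𝓝 ((extChartAt I' x).symm (extChartAt I' x x)),
        ContMDiffAt I' I 1 f z ∧ f z ∈ (extChartAt I (f x)).source :=
      ((contMDiffAt_iff_contMDiffAt_nhds (by simp)).1 (hx'.of_le (by norm_cast : (1 : ℕ∞ω) ≤ ∞))).and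
        (hx'.continuousAt.preimage_mem_nhds ((isOpen_extChartAt_source _).mem_nhds hz))
    filter_upwards [extChartAt_target_mem_nhds_of_mem hx,
      (continuousAt_extChartAt_symm'' hx).eventually hfev] with w hw hw'
    exact DiffForm.inChart_pullback η hw (hw'.1.mdifferentiableAt one_ne_zero) hw'.2
  -- In the charts centred at `x` and `f x`, the differential of the coordinate expression is the
  -- manifold derivative by definition.
  have hmf : (mfderiv I' I f x : E' →L[ℝ] E) =
      fderiv ℝ (extChartAt I (f x) ∘ f ∘ (extChartAt I' x).symm) (extChartAt I' x x) := by
    rw [MDifferentiableAt.mfderiv (hf.mdifferentiableAt (by simp)), I'.range_eq_univ,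
      fderivWithin_univ]
    rfl
  have h1 := extDeriv_pullback (r := ∞) hη' hF
    (by rw [minSmoothness_of_isRCLikeNormedField]; exact WithTop.coe_le_coe.2 le_top)
  rw [DiffForm.d_eq, hev.extDeriv_eq]
  refine h1.trans ?_
  rw [h0, ← hmf, ← DiffForm.d_eq]
  rfl

theorem DiffForm.d_modelSpace (η : DiffForm 𝓘(ℝ, E) E k) (y : E) :
    η.d y = extDeriv (η : E → E [⋀^Fin k]→L[ℝ] ℝ) y := by
  have h1 : η.inChart y = η := by
    funext z
    have h2 : (extChartAt 𝓘(ℝ, E) y).symm = (id : E → E) := by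
      simp only [extChartAt_model_space_eq_id, PartialEquiv.refl_symm, PartialEquiv.refl_coe]
    rw [DiffForm.inChart_eq_pullback, h2]
    refine ContinuousAlternatingMap.ext fun v => ?_
    change η z (fun i => mfderiv 𝓘(ℝ, E) 𝓘(ℝ, E) id z (v i)) = η z v
    rw [mfderiv_id]
    rfl
  rw [DiffForm.d_eq, h1]
  rfl

/-- This is chart independence: `DiffForm.d` uses a different chart at each point. It follows from
naturality of d under the inverse chart. -/
theorem DiffForm.inChart_d [I.Boundaryless] [IsManifold I ∞ M]
    {η : DiffForm I M k} (hη : η.IsSmooth) {x₀ : M} {y : E} (hy : y ∈ (extChartAt I x₀).target) :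
    η.d.inChart x₀ y = extDeriv (η.inChart x₀) y := by
  rw [DiffForm.inChart_eq_pullback, DiffForm.inChart_eq_pullback,
    ← DiffForm.d_pullback hη (contMDiffAt_extChartAt_symm hy)]
  exact DiffForm.d_modelSpace _ y

theorem DiffForm.IsSmooth.d [I.Boundaryless] [IsManifold I ∞ M]
    {η : DiffForm I M k} (hη : η.IsSmooth) : η.d.IsSmooth := by
  intro x₀ y hy
  have h1 : ContDiffAt ℝ ∞ (extDeriv (η.inChart x₀)) y :=
    ContDiffAt.comp y
      (g := ContinuousAlternatingMap.alternatizeUncurryFinCLM ℝ E ℝ (n := k))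
      (ContinuousLinearMap.contDiff _).contDiffAt ((hη.contDiffAt hy).fderiv_right (m := ∞) (by simp))
  refine (h1.congr_of_eventuallyEq ?_).contDiffWithinAt
  filter_upwards [extChartAt_target_mem_nhds_of_mem hy] with w hw using DiffForm.inChart_d hη hw

theorem DiffForm.d_d [I.Boundaryless] [IsManifold I ∞ M]
    {η : DiffForm I M k} (hη : η.IsSmooth) (x : M) : η.d.d x = 0 := by
  have hx := mem_extChartAt_target (I := I) x
  rw [DiffForm.d_eq]
  have h1 : η.d.inChart x =ᶠ[𝓝 (extChartAt I x x)] extDeriv (η.inChart x) := by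
    filter_upwards [extChartAt_target_mem_nhds_of_mem hx] with w hw using DiffForm.inChart_d hη hw
  rw [h1.extDeriv_eq]
  exact extDeriv_extDeriv_apply (hη.contDiffAt hx)
    (by rw [minSmoothness_of_isRCLikeNormedField]; exact WithTop.coe_le_coe.2 le_top)

end FormCalculus

/-! ### Charts of the tangent and cotangent bundles -/

section BundleCharts

variable {E : Type*} [NormedAddCommGroup E] [NormedSpace ℝ E]
  {H : Type*} [TopologicalSpace H] {I : ModelWithCorners ℝ E H}
  {M : Type*} [TopologicalSpace M] [ChartedSpace H M]

section FiberBundle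

variable {F : Type*} [NormedAddCommGroup F] [NormedSpace ℝ F] {V : M → Type*}
  [TopologicalSpace (TotalSpace F V)] [∀ x, TopologicalSpace (V x)] [FiberBundle F V]

theorem proj_extChartAt_symm (v₀ : TotalSpace F V) {z : E × F}
    (hz : z ∈ (extChartAt (I.prod 𝓘(ℝ, F)) v₀).target) :
    ((extChartAt (I.prod 𝓘(ℝ, F)) v₀).symm z).proj = (extChartAt I v₀.proj).symm z.1 := by
  rw [FiberBundle.extChartAt_target] at hz
  rw [FiberBundle.extChartAt]
  exact (trivializationAt F V v₀.proj).proj_symm_apply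
    ((trivializationAt F V v₀.proj).mem_target.2 hz.1.2)

theorem fst_mem_extChartAt_target {v₀ : TotalSpace F V} {z : E × F}
    (hz : z ∈ (extChartAt (I.prod 𝓘(ℝ, F)) v₀).target) : z.1 ∈ (extChartAt I v₀.proj).target := by
  rw [FiberBundle.extChartAt_target] at hz
  exact hz.1.1

theorem mfderiv_proj_comp_extChartAt_symm [I.Boundaryless] [IsManifold I 1 M] (v₀ : TotalSpace F V) {z : E × F}
    (hz : z ∈ (extChartAt (I.prod 𝓘(ℝ, F)) v₀).target) :
    (mfderiv 𝓘(ℝ, E × F) I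
      ((fun v : TotalSpace F V => v.proj) ∘ (extChartAt (I.prod 𝓘(ℝ, F)) v₀).symm) z : E × F →L[ℝ] E) =
    (mfderiv 𝓘(ℝ, E) I (extChartAt I v₀.proj).symm z.1 : E →L[ℝ] E).comp (.fst ℝ E F) := by
  have h1 : (fun v : TotalSpace F V => v.proj) ∘ (extChartAt (I.prod 𝓘(ℝ, F)) v₀).symm =ᶠ[𝓝 z]
      (extChartAt I v₀.proj).symm ∘ Prod.fst := by
    filter_upwards [extChartAt_target_mem_nhds_of_mem hz] with w hw using proj_extChartAt_symm v₀ hw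
  have h2 : HasMFDerivAt 𝓘(ℝ, E × F) 𝓘(ℝ, E) (Prod.fst : E × F → E) z (.fst ℝ E F) :=
    hasFDerivAt_fst.hasMFDerivAt
  have h3 : MDifferentiableAt 𝓘(ℝ, E) I (extChartAt I v₀.proj).symm z.1 :=
    (contMDiffAt_extChartAt_symm (fst_mem_extChartAt_target hz)).mdifferentiableAt one_ne_zero
  exact h1.mfderiv_eq.trans (h3.hasMFDerivAt.comp z h2).mfderiv

end FiberBundle

variable [I.Boundaryless] [IsManifold I 1 M]

theorem extChartAt_tangent_symm (v₀ : TangentBundle I M) {z : E × E}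
    (hz : z ∈ (extChartAt I.tangent v₀).target) :
    (extChartAt I.tangent v₀).symm z = ⟨(extChartAt I v₀.proj).symm z.1,
      (mfderiv 𝓘(ℝ, E) I (extChartAt I v₀.proj).symm z.1 : E →L[ℝ] E) z.2⟩ := by
  have h0 := fst_mem_extChartAt_target hz
  have hx : (extChartAt I v₀.proj).symm z.1 ∈ (chartAt H v₀.proj).source := by
    rw [← extChartAt_source I]
    exact (extChartAt I v₀.proj).map_target h0
  have h2 := TangentBundle.symmL_trivializationAt (I := I) hx
  rw [(extChartAt I v₀.proj).right_inv h0, I.range_eq_univ, mfderivWithin_univ] at h2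
  have hb : (extChartAt I v₀.proj).symm z.1 ∈
      (trivializationAt E (TangentSpace I : M → Type _) v₀.proj).baseSet := by
    rwa [TangentBundle.trivializationAt_baseSet]
  have h3 : (extChartAt I.tangent v₀).symm z =
      (trivializationAt E (TangentSpace I : M → Type _) v₀.proj).toOpenPartialHomeomorph.symm
        ((extChartAt I v₀.proj).symm z.1, z.2) := by
    rw [FiberBundle.extChartAt]
    rfl
  rw [h3, ← (trivializationAt E (TangentSpace I : M → Type _) v₀.proj).mk_symm hb]
  congr 1
  exact ((trivializationAt E (TangentSpace I : M → Type _) v₀.proj).symmL_apply hb _).symm.trans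
    (DFunLike.congr_fun h2 z.2)

/-- The trivialization of a bundle of homomorphisms precomposes a covector with the inverse
trivialization of the tangent bundle, which is the differential of the inverse chart. -/
theorem cotangent_extChartAt_symm_comp (α₀ : Cotangent I M) {z : E × (E →L[ℝ] ℝ)}
    (hz : z ∈ (extChartAt (cotangentModel I) α₀).target) :
    (((extChartAt (cotangentModel I) α₀).symm z).snd : E →L[ℝ] ℝ).comp
      (mfderiv 𝓘(ℝ, E) I (extChartAt I α₀.proj).symm z.1 : E →L[ℝ] E) = z.2 := by
  have h0 := fst_mem_extChartAt_target hz
  set α := (extChartAt (cotangentModel I) α₀).symm z with hα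
  have hp : α.proj = (extChartAt I α₀.proj).symm z.1 := proj_extChartAt_symm α₀ hz
  have hx : α.proj ∈ (chartAt H α₀.proj).source := by
    rw [hp, ← extChartAt_source I]
    exact (extChartAt I α₀.proj).map_target h0
  have h2 := TangentBundle.symmL_trivializationAt (I := I) hx
  rw [I.range_eq_univ, mfderivWithin_univ, hp, (extChartAt I α₀.proj).right_inv h0, ← hp] at h2
  have h3 : extChartAt (cotangentModel I) α₀ α = z := (extChartAt (cotangentModel I) α₀).right_inv hz
  rw [FiberBundle.extChartAt] at h3
  have h4 : (trivializationAt (E →L[ℝ] ℝ) (fun x : M => TangentSpace I x →L[ℝ] Trivial M ℝ x)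
      α₀.proj α).2 = z.2 := congrArg Prod.snd h3
  rw [hom_trivializationAt_apply] at h4
  rw [← h4]
  simp only [ContinuousLinearMap.inCoordinates]
  rw [h2]
  refine ContinuousLinearMap.ext fun w => ?_
  exact (DFunLike.congr_fun
    (Trivial.continuousLinearMapAt_trivialization (𝕜 := ℝ) M ℝ α.proj) _).symm

end BundleCharts

/-- The function is linear in the fibre variable. This derivative is the only term surviving in
`dT_apply_vertical`. -/
theorem fderiv_apply_snd_vertical {E : Type*} [NormedAddCommGroup E] [NormedSpace ℝ E]
    {Ω : E → E [⋀^Fin 2]→L[ℝ] ℝ} {z : E × E} (hΩ : DifferentiableAt ℝ Ω z.1) (a b : E) :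
    fderiv ℝ (fun y : E × E => Ω y.1 ![y.2, a]) z (0, b) = Ω z.1 ![b, a] := by
  have hf : HasFDerivAt (fun y : E × E => Ω y.1)
      ((fderiv ℝ Ω z.1).comp (.fst ℝ E E)) z := hΩ.hasFDerivAt.comp z hasFDerivAt_fst
  let g : Fin 2 → E × E → E := ![Prod.snd, fun _ => a]
  let g' : Fin 2 → E × E →L[ℝ] E := ![.snd ℝ E E, 0]
  have hg : ∀ i, HasFDerivAt (g i) (g' i) z := by
    intro i
    fin_cases i
    · exact hasFDerivAt_snd
    · exact hasFDerivAt_const a z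
  have hgz : ∀ y : E × E, (fun i => g i y) = ![y.2, a] := by
    intro y; funext i; fin_cases i <;> rfl
  have h := (hf.continuousAlternatingMap_apply hg).fderiv
  simp only [hgz] at h
  rw [h]
  have h1 : Function.update ![z.2, a] 0 b = ![b, a] := by
    funext i; fin_cases i <;> rfl
  simp [g', h1]

/-! ### The operator i_T, the canonical forms and the complete lift -/

section BundleForms

variable {E : Type*} [NormedAddCommGroup E] [NormedSpace ℝ E]
  {H : Type*} [TopologicalSpace H] {I : ModelWithCorners ℝ E H}
  {M : Type*} [TopologicalSpace M] [ChartedSpace H M] [IsManifold I ∞ M]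

theorem DiffForm.inChart_self {k : ℕ} (η : DiffForm I M k) (x : M) :
    η.inChart x (extChartAt I x x) = η x := by
  let η' : M → E [⋀^Fin k]→L[ℝ] ℝ := η
  have key : ∀ (x' : M) (D : E →L[ℝ] E), x' = x → D = ContinuousLinearMap.id ℝ E →
      (η' x').compContinuousLinearMap D = η' x := by
    rintro _ _ rfl rfl
    rfl
  exact key _ _ (extChartAt_to_inv x) mfderivWithin_range_extChartAt_symm

theorem dT_eq_of_isPresymplectic {η : DiffForm I M 2} (hη : IsPresymplectic η) :
    η.dT = η.iT.d := by
  funext v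
  have h0 : η.d = fun _ => 0 := funext hη.closed
  have h1 : η.d.iT v = 0 := by
    rw [h0]
    exact ContinuousAlternatingMap.ext fun w => rfl
  rw [DiffForm.dT, h1, add_zero]

variable [I.Boundaryless]

/-- The coordinate expression of `i_T η`: `(x, v) ↦ η_x (v, …)`. -/
theorem DiffForm.inChart_iT {k : ℕ} (η : DiffForm I M (k + 1)) (v₀ : TangentBundle I M) {z : E × E}
    (hz : z ∈ (extChartAt I.tangent v₀).target) :
    η.iT.inChart v₀ z =
      ((η.inChart v₀.proj z.1).curryLeft z.2).compContinuousLinearMap (.fst ℝ E E) := by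
  have h0 := fst_mem_extChartAt_target hz
  have h1 := mfderiv_proj_comp_extChartAt_symm (I := I) v₀ hz
  have h2 : MDifferentiableAt I.tangent I (fun v : TangentBundle I M => v.proj)
      ((extChartAt I.tangent v₀).symm z) :=
    (contMDiff_proj (n := 1) (TangentSpace I : M → Type _)).mdifferentiable one_ne_zero _
  have h3 : MDifferentiableAt 𝓘(ℝ, E × E) I.tangent (extChartAt I.tangent v₀).symm z :=
    (contMDiffAt_extChartAt_symm (n := 1) hz).mdifferentiableAt one_ne_zero
  let η' : M → E [⋀^Fin (k + 1)]→L[ℝ] ℝ := η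
  refine ContinuousAlternatingMap.ext fun w => ?_
  have key : ∀ (v : TangentBundle I M) (D : E × E →L[ℝ] E),
      v = ⟨(extChartAt I v₀.proj).symm z.1,
        (mfderiv 𝓘(ℝ, E) I (extChartAt I v₀.proj).symm z.1 : E →L[ℝ] E) z.2⟩ →
      D = (mfderiv 𝓘(ℝ, E) I (extChartAt I v₀.proj).symm z.1 : E →L[ℝ] E).comp (.fst ℝ E E) →
      η' v.proj (Matrix.vecCons (v.snd : E) fun i => D (w i)) =
        η.inChart v₀.proj z.1 (Matrix.vecCons z.2 fun i => (w i).1) := by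
    rintro _ _ rfl rfl
    rw [DiffForm.inChart_eq_pullback]
    change _ = η' _ _
    congr 1
    funext j
    refine Fin.cases rfl (fun j => rfl) j
  rw [DiffForm.inChart_eq_pullback]
  exact key _ _ (extChartAt_tangent_symm v₀ hz) ((mfderiv_comp z h2 h3).symm.trans h1)

/-- The coordinate formula θ = p dq, from which smoothness of θ is read off. -/
theorem canonicalOneForm_inChart (α₀ : Cotangent I M) {z : E × (E →L[ℝ] ℝ)}
    (hz : z ∈ (extChartAt (cotangentModel I) α₀).target) :
    (canonicalOneForm I M).inChart α₀ z =
      ContinuousAlternatingMap.ofSubsingleton ℝ (E × (E →L[ℝ] ℝ)) ℝ (0 : Fin 1)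
        (z.2.comp (.fst ℝ E (E →L[ℝ] ℝ))) := by
  have h1 := mfderiv_proj_comp_extChartAt_symm (I := I) α₀ hz
  have h2 : MDifferentiableAt (cotangentModel I) I (fun v : Cotangent I M => v.proj)
      ((extChartAt (cotangentModel I) α₀).symm z) :=
    (contMDiff_proj (n := 1) (fun x : M => TangentSpace I x →L[ℝ] Trivial M ℝ x)).mdifferentiable
      one_ne_zero _
  have h3 : MDifferentiableAt 𝓘(ℝ, E × (E →L[ℝ] ℝ)) (cotangentModel I)
      (extChartAt (cotangentModel I) α₀).symm z :=
    (contMDiffAt_extChartAt_symm (n := 1) hz).mdifferentiableAt one_ne_zero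
  have h4 : _ = _ := (mfderiv_comp z h2 h3).symm.trans h1
  have h5 := cotangent_extChartAt_symm_comp α₀ hz
  rw [DiffForm.inChart_eq_pullback]
  refine ContinuousAlternatingMap.ext fun w => ?_
  rw [← h5]
  exact congrArg (((extChartAt (cotangentModel I) α₀).symm z).snd : E →L[ℝ] ℝ)
    (DFunLike.congr_fun h4 (w 0))

theorem DiffForm.IsSmooth.iT {k : ℕ} {η : DiffForm I M (k + 1)} (hη : η.IsSmooth) :
    η.iT.IsSmooth := by
  intro v₀ z hz
  have h1 : ContDiffAt ℝ ∞ (fun w : E × E => η.inChart v₀.proj w.1) z :=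
    ContDiffAt.comp z (g := η.inChart v₀.proj) (hη.contDiffAt (fst_mem_extChartAt_target hz))
      contDiffAt_fst
  have h2 : ContDiffAt ℝ ∞ (fun w : E × E => (η.inChart v₀.proj w.1).curryLeft w.2) z :=
    ContDiffAt.clm_apply (f := fun w : E × E => (η.inChart v₀.proj w.1).curryLeft)
      (ContDiffAt.comp z (g := ContinuousAlternatingMap.curryLeftLI (𝕜 := ℝ) (E := E) (F := ℝ)
        (n := k)) (LinearIsometry.contDiff _).contDiffAt h1) contDiffAt_snd
  have h3 : ContDiffAt ℝ ∞ (fun w : E × E => ((η.inChart v₀.proj w.1).curryLeft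
      w.2).compContinuousLinearMap (.fst ℝ E E)) z :=
    ContDiffAt.comp z (g := ContinuousAlternatingMap.compContinuousLinearMapCLM (ι := Fin k)
      (.fst ℝ E E)) (ContinuousLinearMap.contDiff _).contDiffAt h2
  refine (h3.congr_of_eventuallyEq ?_).contDiffWithinAt
  filter_upwards [extChartAt_target_mem_nhds_of_mem hz] with w hw using DiffForm.inChart_iT η v₀ hw

variable (I M) in
theorem canonicalOneForm_isSmooth : (canonicalOneForm I M).IsSmooth := by
  intro α₀ z hz
  have h1 : ContDiffAt ℝ ∞ (fun w : E × (E →L[ℝ] ℝ) =>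
      ContinuousAlternatingMap.ofSubsingleton ℝ (E × (E →L[ℝ] ℝ)) ℝ (0 : Fin 1)
        (w.2.comp (.fst ℝ E (E →L[ℝ] ℝ)))) z :=
    ContDiffAt.comp z (g := ContinuousAlternatingMap.ofSubsingletonLIE (𝕜 := ℝ)
      (E := E × (E →L[ℝ] ℝ)) (F := ℝ) (0 : Fin 1))
      (f := fun w : E × (E →L[ℝ] ℝ) => w.2.comp (.fst ℝ E (E →L[ℝ] ℝ)))
      (LinearIsometryEquiv.contDiff _).contDiffAt (contDiffAt_snd.clm_comp contDiffAt_const)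
  refine (h1.congr_of_eventuallyEq ?_).contDiffWithinAt
  filter_upwards [extChartAt_target_mem_nhds_of_mem hz] with w hw using canonicalOneForm_inChart α₀ hw

variable (I M) in
theorem canonicalTwoForm_isPresymplectic : IsPresymplectic (canonicalTwoForm I M) := by
  have h := canonicalOneForm_isSmooth I M
  have h1 : ∀ α₀, (canonicalTwoForm I M).inChart α₀ = -((canonicalOneForm I M).d.inChart α₀) := by
    intro α₀
    rfl
  refine ⟨fun α₀ => ?_, fun α => ?_⟩
  · rw [h1]
    exact (h.d α₀).neg
  · rw [DiffForm.d_eq, h1]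
    have h2 := DiffForm.d_d h α
    rw [DiffForm.d_eq] at h2
    rw [← neg_one_smul ℝ ((canonicalOneForm I M).d.inChart α), extDeriv_smul]
    exact (congrArg _ h2).trans (smul_zero (-1 : ℝ))

theorem IsPresymplectic.dT {η : DiffForm I M 2} (hη : IsPresymplectic η) :
    IsPresymplectic η.dT := by
  rw [dT_eq_of_isPresymplectic hη]
  exact ⟨hη.smooth.iT.d, DiffForm.d_d hη.smooth.iT⟩

theorem IsPresymplectic.pullback {η : DiffForm I M 2} (hη : IsPresymplectic η)
    {E' : Type*} [NormedAddCommGroup E'] [NormedSpace ℝ E'] {H' : Type*} [TopologicalSpace H']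
    {I' : ModelWithCorners ℝ E' H'} [I'.Boundaryless] {M' : Type*} [TopologicalSpace M']
    [ChartedSpace H' M'] [IsManifold I' ∞ M'] {f : M' → M} (hf : ContMDiff I' I ∞ f) :
    IsPresymplectic (DiffForm.pullback (I' := I') f η) := by
  refine ⟨hη.smooth.pullback hf, fun x => ?_⟩
  rw [DiffForm.d_pullback hη.smooth hf.contMDiffAt, DiffForm.pullback, hη.closed]
  rfl

/-- The complete lift evaluated on a vertical vector. -/
theorem dT_apply_vertical {η : DiffForm I M 2} (hη : IsPresymplectic η) (v : TangentBundle I M)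
    (b : E) (w : E × E) :
    (η.dT v : (E × E) [⋀^Fin 2]→L[ℝ] ℝ) ![(0, b), w] =
      (η v.proj : E [⋀^Fin 2]→L[ℝ] ℝ) ![b, w.1] := by
  have hz := mem_extChartAt_target (I := I.tangent) v
  set z := extChartAt I.tangent v v with hzdef
  have hz1 : z.1 = extChartAt I v.proj v.proj := by
    rw [← (extChartAt I v.proj).right_inv (fst_mem_extChartAt_target hz),
      ← proj_extChartAt_symm v hz, extChartAt_to_inv]
  rw [dT_eq_of_isPresymplectic hη, DiffForm.d_eq, ← hzdef]
  have hd : DifferentiableAt ℝ (η.iT.inChart v) z :=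
    (hη.smooth.iT.contDiffAt hz).differentiableAt (by simp)
  have hev : ∀ u : E × E, (fun y => η.iT.inChart v y ![u]) =ᶠ[𝓝 z]
      fun y => η.inChart v.proj y.1 ![y.2, u.1] := by
    intro u
    filter_upwards [extChartAt_target_mem_nhds_of_mem hz] with y hy
    rw [DiffForm.inChart_iT η v hy]
    change η.inChart v.proj y.1 _ = η.inChart v.proj y.1 _
    congr 1
    funext j
    fin_cases j <;> rfl
  refine (extDeriv_apply hd ![((0, b) : E × E), w]).trans ?_
  rw [Fin.sum_univ_two]
  have e0 : Fin.removeNth 0 ![((0, b) : E × E), w] = ![w] := by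
    funext j; fin_cases j; rfl
  have e1 : Fin.removeNth 1 ![((0, b) : E × E), w] = ![(0, b)] := by
    funext j; fin_cases j; rfl
  simp only [e0, e1, Matrix.cons_val_zero, Matrix.cons_val_one]
  -- The form i_T η only sees first components of its arguments, so it vanishes identically on the
  -- constant vertical field.
  have h1 : fderiv ℝ (fun y => η.iT.inChart v y ![((0, b) : E × E)]) z w = 0 := by
    have : (fun y : E × E => η.inChart v.proj y.1 ![y.2, ((0, b) : E × E).1]) = fun _ => 0 := by
      funext y
      exact (η.inChart v.proj y.1).map_coord_zero 1 rfl
    rw [(hev _).fderiv_eq, this]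
    simp
  have h0 : fderiv ℝ (fun y => η.iT.inChart v y ![w]) z (0, b) = η.inChart v.proj z.1 ![b, w.1] := by
    have h2 : DifferentiableAt ℝ (η.inChart v.proj) z.1 :=
      (hη.smooth.contDiffAt (fst_mem_extChartAt_target hz)).differentiableAt (by simp)
    rw [(hev _).fderiv_eq]
    exact fderiv_apply_snd_vertical h2 w.1 b
  rw [h0, h1, hz1, DiffForm.inChart_self]
  simp
  rfl

end BundleForms

/-- The inverse function theorem for maps which are smooth on an open set. -/
theorem exists_openPartialHomeomorph_of_contDiffOn {E F : Type*} [NormedAddCommGroup E]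
    [NormedSpace ℝ E] [CompleteSpace E] [NormedAddCommGroup F] [NormedSpace ℝ F] {f : E → F}
    {U : Set E} (hU : IsOpen U) (hf : ContDiffOn ℝ ∞ f U) {a : E} (ha : a ∈ U) (f' : E ≃L[ℝ] F)
    (hf' : HasFDerivAt f (f' : E →L[ℝ] F) a) :
    ∃ e : OpenPartialHomeomorph E F, (e : E → F) = f ∧ a ∈ e.source ∧ e.source ⊆ U ∧
      ContDiffOn ℝ ∞ e e.source ∧ ContDiffOn ℝ ∞ e.symm e.target := by
  have hfa : ∀ x ∈ U, ContDiffAt ℝ ∞ f x := fun x hx => hf.contDiffAt (hU.mem_nhds hx)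
  let e₀ := (hfa a ha).toOpenPartialHomeomorph f hf' (by simp)
  -- Keeping only points with invertible differential makes the inverse smooth on its whole domain,
  -- not just at the image of `a`.
  let V : Set E := U ∩ fderiv ℝ f ⁻¹' range ((↑) : (E ≃L[ℝ] F) → E →L[ℝ] F)
  have hV : IsOpen V := (hf.continuousOn_fderiv_of_isOpen hU (by norm_cast)).isOpen_inter_preimage
    hU ContinuousLinearEquiv.isOpen
  have haV : a ∈ V := ⟨ha, f', hf'.fderiv.symm⟩
  refine ⟨e₀.restrOpen V hV, rfl, ⟨?_, haV⟩, fun x hx => hx.2.1,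
    fun x hx => (hfa x hx.2.1).contDiffWithinAt, fun y hy => ?_⟩
  · exact ContDiffAt.mem_toOpenPartialHomeomorph_source _ _ _
  · have hx : (e₀.restrOpen V hV).symm y ∈ (e₀.restrOpen V hV).source :=
      (e₀.restrOpen V hV).map_target hy
    obtain ⟨g, hg⟩ := hx.2.2
    refine ((e₀.restrOpen V hV).contDiffAt_symm (f₀' := g) hy ?_ (hfa _ hx.2.1)).contDiffWithinAt
    rw [hg]
    exact ((hfa _ hx.2.1).differentiableAt (by simp)).hasFDerivAt

theorem exists_continuousLinearEquiv_prod_extending {E F E' : Type*} [NormedAddCommGroup E]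
    [NormedSpace ℝ E] [NormedAddCommGroup F] [NormedSpace ℝ F] [NormedAddCommGroup E']
    [NormedSpace ℝ E'] [FiniteDimensional ℝ E] [FiniteDimensional ℝ F] [FiniteDimensional ℝ E']
    (hdim : Module.finrank ℝ E + Module.finrank ℝ F = Module.finrank ℝ E')
    (D : E →L[ℝ] E') (hD : Injective D) :
    ∃ e : (E × F) ≃L[ℝ] E', ∀ u, e (u, 0) = D u := by
  obtain ⟨q, hq⟩ := Submodule.exists_isCompl (LinearMap.range (D : E →ₗ[ℝ] E'))
  have h1 := Submodule.finrank_add_eq_of_isCompl hq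
  rw [LinearMap.finrank_range_of_inj hD] at h1
  let eF : F ≃ₗ[ℝ] q := LinearEquiv.ofFinrankEq F q (by omega)
  let e : (E × F) ≃ₗ[ℝ] E' :=
    ((LinearEquiv.ofInjective (D : E →ₗ[ℝ] E') hD).prodCongr eF).trans
      (Submodule.prodEquivOfIsCompl _ q hq)
  refine ⟨e.toContinuousLinearEquiv, fun u => ?_⟩
  change e (u, 0) = D u
  simp [e]

/-! ### Immersions, retractions and maps into tangent bundles -/

section Immersion

variable {E : Type*} [NormedAddCommGroup E] [NormedSpace ℝ E]
  {E' : Type*} [NormedAddCommGroup E'] [NormedSpace ℝ E']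
  {H : Type*} [TopologicalSpace H] {I : ModelWithCorners ℝ E H}
  {H' : Type*} [TopologicalSpace H'] {J : ModelWithCorners ℝ E' H'}
  {M : Type*} [TopologicalSpace M] [ChartedSpace H M]
  {N : Type*} [TopologicalSpace N] [ChartedSpace H' N]

theorem tangentMap_tangentMap_of_eventually_leftInverse {f : M → N} {r : N → M}
    {w : TangentBundle I M} (hf : MDifferentiableAt I J f w.proj)
    (hr : MDifferentiableAt J I r (f w.proj)) (h : ∀ᶠ y in 𝓝 w.proj, r (f y) = y) :
    tangentMap J I r (tangentMap I J f w) = w := by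
  have key : ∀ (q : M) (D : E →L[ℝ] E), q = w.proj → D = ContinuousLinearMap.id ℝ E →
      (⟨q, D w.2⟩ : TangentBundle I M) = w := by
    rintro _ _ rfl rfl
    rfl
  refine key (r (f w.proj)) ((mfderiv J I r (f w.proj)).comp (mfderiv I J f w.proj))
    h.self_of_nhds ?_
  have h1 : r ∘ f =ᶠ[𝓝 w.proj] id := h
  have h2 := mfderiv_comp w.proj hr hf
  rw [h1.mfderiv_eq, mfderiv_id] at h2
  exact h2.symm

/-- An immersion has a local smooth retraction. -/
theorem _root_.Manifold.IsImmersionAt.exists_retraction [I.Boundaryless] {f : M → N} {x : M}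
    (hf : IsImmersionAt I J ∞ f x) :
    ∃ (r : N → M) (V : Set N), IsOpen V ∧ f x ∈ V ∧ ContMDiffOn J I ∞ r V ∧
      ∀ᶠ y in 𝓝 x, r (f y) = y := by
  -- In adapted charts the immersion is u ↦ (u, 0); `p` forgets the complementary coordinate.
  let p : E' → E := fun z => (hf.equiv.symm z).1
  have hp : ContDiff ℝ ∞ p := contDiff_fst.comp hf.equiv.symm.contDiff
  have key : ∀ y ∈ hf.domChart.source, p (hf.codChart.extend J (f y)) = hf.domChart.extend I y := by
    intro y hy
    have h1 := hf.writtenInCharts ((hf.domChart.extend I).map_source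
      (by rwa [OpenPartialHomeomorph.extend_source]))
    simp only [comp_apply, hf.domChart.extend_left_inv hy] at h1
    simp only [p, h1, ContinuousLinearEquiv.symm_apply_apply]
  let V : Set N := hf.codChart.source ∩ hf.codChart.extend J ⁻¹' (p ⁻¹' (hf.domChart.extend I).target)
  have hV : IsOpen V := by
    have := (hf.codChart.continuousOn_extend (I := J)).isOpen_inter_preimage
      hf.codChart.isOpen_extend_source ((hf.domChart.isOpen_extend_target (I := I)).preimage
        hp.continuous)
    rwa [OpenPartialHomeomorph.extend_source] at this
  refine ⟨fun z => (hf.domChart.extend I).symm (p (hf.codChart.extend J z)), V, hV, ⟨?_, ?_⟩, ?_, ?_⟩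
  · exact hf.mem_codChart_source
  · change p (hf.codChart.extend J (f x)) ∈ (hf.domChart.extend I).target
    rw [key x hf.mem_domChart_source]
    exact (hf.domChart.extend I).map_source (by simpa using hf.mem_domChart_source)
  · have h1 := contMDiffOn_extend_symm (I := I) hf.domChart_mem_maximalAtlas
    rw [← OpenPartialHomeomorph.extend_target'] at h1
    exact h1.comp (hp.contMDiff.comp_contMDiffOn
      ((hf.codChart.contMDiffOn_extend hf.codChart_mem_maximalAtlas).mono inter_subset_left))
      fun z hz => hz.2
  · filter_upwards [hf.domChart.open_source.mem_nhds hf.mem_domChart_source] with y hy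
    rw [key y hy, hf.domChart.extend_left_inv hy]

theorem _root_.Manifold.IsImmersionAt.injective_mfderiv [I.Boundaryless] {f : M → N} {x : M}
    (hf : IsImmersionAt I J ∞ f x) : Injective (mfderiv I J f x) := by
  obtain ⟨r, V, hV, hxV, hr, hrf⟩ := hf.exists_retraction
  have h1 : r ∘ f =ᶠ[𝓝 x] id := hrf
  have h2 := mfderiv_comp x ((hr.contMDiffAt (hV.mem_nhds hxV)).mdifferentiableAt (by simp))
    (hf.contMDiffAt.mdifferentiableAt (by simp))
  rw [h1.mfderiv_eq, mfderiv_id] at h2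
  intro a b hab
  have h3 := DFunLike.congr_fun h2 a
  have h4 := DFunLike.congr_fun h2 b
  exact h3.trans ((congrArg (mfderiv J I r (f x)) hab).trans h4.symm)

/-- Velocities of curves in an embedded submanifold are tangent to it. -/
theorem exists_tangentMap_eq_of_mem_tangentSet {f : M → N} (hf : IsSmoothEmbedding I J ∞ f)
    {v : TangentBundle J N} (hv : v ∈ tangentSet J (range f)) :
    ∃ w : TangentBundle I M, tangentMap I J f w = v := by
  obtain ⟨γ, hγ, hγf, rfl⟩ := hv
  choose δ hδ using hγf
  have h1 : f ∘ δ = γ := funext hδ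
  have h2 : ContMDiff 𝓘(ℝ, ℝ) I ∞ δ := by
    -- Continuity of the lifted curve comes from the topological embedding, smoothness from the
    -- immersion.
    rw [ContMDiff.iff_comp_isImmersion hf.isImmersion, hf.isEmbedding.isInducing.continuous_iff, h1]
    exact ⟨hγ.continuous, hγ⟩
  refine ⟨tangentMap 𝓘(ℝ, ℝ) I δ ⟨0, (1 : ℝ)⟩, ?_⟩
  rw [← h1, tangentMap_comp_at _ (hf.contMDiff.mdifferentiableAt (by simp))
    (h2.mdifferentiableAt (by simp))]

variable {E₁ : Type*} [NormedAddCommGroup E₁] [NormedSpace ℝ E₁]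
  {H₁ : Type*} [TopologicalSpace H₁] {K : ModelWithCorners ℝ E₁ H₁}
  {S : Type*} [TopologicalSpace S] [ChartedSpace H₁ S]

variable [I.Boundaryless] [IsManifold I ∞ M] [IsManifold J ∞ N]

/-- A smooth map into the tangent bundle of an embedded submanifold, considered as a map into the
tangent bundle of the ambient manifold, is smooth as a map into the submanifold. -/
theorem contMDiff_of_tangentMap_comp {f : M → N} (hf : IsSmoothEmbedding I J ∞ f)
    {g : S → TangentBundle I M} (hg : ContMDiff K J.tangent ∞ fun s => tangentMap I J f (g s)) :
    ContMDiff K I.tangent ∞ g := by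
  intro s₀
  have hproj : Continuous fun s => (g s).proj := by
    rw [hf.isEmbedding.isInducing.continuous_iff]
    exact (FiberBundle.continuous_proj E' (TangentSpace J (M := N))).comp hg.continuous
  -- Near `s₀`, `g` is Tr applied to Tf ∘ g, a composite of smooth maps.
  obtain ⟨r, V, hV, hxV, hr, hrf⟩ :=
    (hf.isImmersion.isImmersionAt (g s₀).proj).exists_retraction
  have h1 : ContMDiffAt K I.tangent ∞
      (fun s => tangentMapWithin J I r V (tangentMap I J f (g s))) s₀ := by
    refine ContMDiffAt.comp s₀ (g := tangentMapWithin J I r V) (I' := J.tangent) ?_ hg.contMDiffAt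
    refine (hr.contMDiffOn_tangentMapWithin (m := ∞) (by simp) hV.uniqueMDiffOn).contMDiffAt ?_
    exact (hV.preimage (FiberBundle.continuous_proj E' (TangentSpace J (M := N)))).mem_nhds hxV
  refine h1.congr_of_eventuallyEq ?_
  have h2 : ∀ᶠ s in 𝓝 s₀, ∀ᶠ y in 𝓝 (g s).proj, r (f y) = y :=
    hproj.continuousAt.eventually (eventually_eventually_nhds.2 hrf)
  have h3 : ∀ᶠ s in 𝓝 s₀, f (g s).proj ∈ V :=
    (hf.contMDiff.continuous.comp hproj).continuousAt.eventually_mem (hV.mem_nhds hxV)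
  filter_upwards [h2, h3] with s hs hsV
  have h4 : tangentMapWithin J I r V (tangentMap I J f (g s)) =
      tangentMap J I r (tangentMap I J f (g s)) := by
    have h5 : (tangentMap I J f (g s)).proj ∈ V := hsV
    rw [tangentMapWithin, mfderivWithin_of_isOpen hV h5]
    rfl
  rw [h4]
  exact (tangentMap_tangentMap_of_eventually_leftInverse
    (hf.contMDiff.mdifferentiableAt (by simp))
    ((hr.contMDiffAt (hV.mem_nhds hsV)).mdifferentiableAt (by simp)) hs).symm

section Target

variable [J.Boundaryless]

/-- A chart followed by a local diffeomorphism of the model vector space. -/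
theorem exists_mem_maximalAtlas_extend_eq (y : N) (e : OpenPartialHomeomorph E' E')
    (he : ContDiffOn ℝ ∞ e e.source) (he' : ContDiffOn ℝ ∞ e.symm e.target) :
    ∃ φ ∈ IsManifold.maximalAtlas J ∞ N,
      φ.source = (chartAt H' y).source ∩ extChartAt J y ⁻¹' e.source ∧
      (φ.extend J : N → E') = e ∘ extChartAt J y := by
  -- Without boundary `J` identifies `H'` with `E'`, so `e` can be conjugated to a local
  -- homeomorphism of `H'`.
  let h : OpenPartialHomeomorph H' E' := J.toHomeomorph.toOpenPartialHomeomorph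
  refine ⟨(chartAt H' y).trans (h.trans (e.trans h.symm)), ?_, ?_, ?_⟩
  · apply OpenPartialHomeomorph.mem_maximalAtlas_of_contMDiffOn
    · have h1 : ContMDiffOn J 𝓘(ℝ, E') ∞ (e ∘ extChartAt J y)
          ((chartAt H' y).source ∩ extChartAt J y ⁻¹' e.source) :=
        he.contMDiffOn.comp (contMDiffOn_extChartAt.mono inter_subset_left) inter_subset_right
      refine (J.contMDiffOn_symm.comp h1 (fun x _ => by simp [J.range_eq_univ])).mono ?_
      intro x hx
      simp [h] at hx
      exact hx
    · have h1 : ContMDiffOn J J ∞ ((extChartAt J y).symm ∘ e.symm ∘ J)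
          (J ⁻¹' (e.target ∩ e.symm ⁻¹' (extChartAt J y).target)) :=
        (contMDiffOn_extChartAt_symm y).comp
          (he'.contMDiffOn.comp J.contMDiff.contMDiffOn fun x hx => hx.1) fun x hx => hx.2
      refine ContMDiffOn.congr (h1.mono ?_) ?_
      · intro x hx
        simp [h] at hx
        refine ⟨hx.1, ?_⟩
        simp [J.range_eq_univ]
        exact hx.2
      · intro x _
        rfl
  · ext x
    simp [h]
  · funext x
    simp [h, J.right_inv, J.range_eq_univ]

variable [FiniteDimensional ℝ E] [FiniteDimensional ℝ E']

/-- A smooth map with injective differential is an immersion. -/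
theorem isImmersionAtOfComplement_of_injective_mfderiv (F : Type*) [NormedAddCommGroup F]
    [NormedSpace ℝ F] [FiniteDimensional ℝ F]
    (hdim : Module.finrank ℝ E + Module.finrank ℝ F = Module.finrank ℝ E')
    {f : M → N} (hf : ContMDiff I J ∞ f) (x : M) (hx : Injective (mfderiv I J f x)) :
    IsImmersionAtOfComplement F I J ∞ f x := by
  set a := extChartAt I x x with ha
  let g : E → E' := writtenInExtChartAt I J x f
  let U₀ : Set E := (extChartAt I x).target ∩ (extChartAt I x).symm ⁻¹'
    (f ⁻¹' (extChartAt J (f x)).source)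
  have hU₀ : IsOpen U₀ := (continuousOn_extChartAt_symm x).isOpen_inter_preimage
    (isOpen_extChartAt_target x) ((isOpen_extChartAt_source (f x)).preimage hf.continuous)
  have haU₀ : a ∈ U₀ := ⟨mem_extChartAt_target x, by simp [a]⟩
  have hg : ContDiffOn ℝ ∞ g U₀ := by
    rw [← contMDiffOn_iff_contDiffOn]
    refine contMDiffOn_extChartAt.comp (hf.comp_contMDiffOn
      ((contMDiffOn_extChartAt_symm x).mono inter_subset_left)) ?_
    intro y hy
    simpa using hy.2
  let D : E →L[ℝ] E' := mfderiv I J f x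
  have hga : HasFDerivAt g D a := by
    have h1 : HasFDerivWithinAt g D (range I) a :=
      (hf.mdifferentiableAt (x := x) (by simp)).hasMFDerivAt.2
    rwa [I.range_eq_univ, hasFDerivWithinAt_univ] at h1
  obtain ⟨e, he⟩ := exists_continuousLinearEquiv_prod_extending hdim D hx
  -- `Ψ` thickens `g` along a complement of the image of `D`. Its differential at e(a, 0) is the
  -- identity, and its local inverse, composed with the target chart, turns `f` into u ↦ e(u, 0).
  let Ψ : E' → E' := fun z => g (e.symm z).1 + e (0, (e.symm z).2)
  let U : Set E' := (fun z => (e.symm z).1) ⁻¹' U₀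
  have hUo : IsOpen U := hU₀.preimage (by fun_prop)
  have hΨ : ContDiffOn ℝ ∞ Ψ U := by
    refine ContDiffOn.add (hg.comp (t := U₀) (f := fun z => (e.symm z).1) ?_ fun z hz => hz) ?_
    · exact (contDiff_fst.comp e.symm.contDiff).contDiffOn
    · exact (e.contDiff.comp (contDiff_const.prodMk
        (contDiff_snd.comp e.symm.contDiff))).contDiffOn
  have haU : e (a, 0) ∈ U := by simpa [U] using haU₀
  have hΨ' : HasFDerivAt Ψ ((ContinuousLinearEquiv.refl ℝ E' : E' ≃L[ℝ] E') : E' →L[ℝ] E')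
      (e (a, 0)) := by
    have h1 : HasFDerivAt (fun z => g (e.symm z).1) (D.comp
        ((ContinuousLinearMap.fst ℝ E F).comp (e.symm : E' →L[ℝ] E × F))) (e (a, 0)) := by
      refine HasFDerivAt.comp (e (a, 0)) (g := g) (f := fun z => (e.symm z).1) ?_
        ((ContinuousLinearMap.fst ℝ E F).comp (e.symm : E' →L[ℝ] E × F)).hasFDerivAt
      simpa using hga
    have h2 := ((e : E × F →L[ℝ] E').comp ((ContinuousLinearMap.inr ℝ E F).comp
      ((ContinuousLinearMap.snd ℝ E F).comp (e.symm : E' →L[ℝ] E × F)))).hasFDerivAt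
        (x := e (a, 0))
    refine (h1.add h2).congr_fderiv ?_
    ext z
    change D (e.symm z).1 + e (0, (e.symm z).2) = z
    rw [← he, ← map_add]
    simp
  obtain ⟨ε, hεΨ, hεa, hεU, hε1, hε2⟩ := exists_openPartialHomeomorph_of_contDiffOn hUo hΨ haU _ hΨ'
  have hΨe : ∀ u, Ψ (e (u, 0)) = g u := by
    intro u
    have : e ((0 : E), (0 : F)) = 0 := map_zero e
    simp [Ψ, this]
  obtain ⟨ψ, hψ, hψs, hψe⟩ := exists_mem_maximalAtlas_extend_eq (J := J) (f x) ε.symm hε2 hε1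
  let W : Set E := (fun u => e (u, 0)) ⁻¹' ε.source
  have hW : IsOpen W := ε.open_source.preimage (by fun_prop)
  have hWM : IsOpen ((chartAt H x).source ∩ extChartAt I x ⁻¹' W) := by
    have := (continuousOn_extChartAt (I := I) x).isOpen_inter_preimage
      (isOpen_extChartAt_source x) hW
    rwa [extChartAt_source] at this
  refine IsImmersionAtOfComplement.mk_of_continuousAt hf.continuous.continuousAt e
    ((chartAt H x).restr ((chartAt H x).source ∩ extChartAt I x ⁻¹' W)) ψ ?_ ?_
    (restr_mem_maximalAtlas _ (IsManifold.chart_mem_maximalAtlas x) hWM) hψ ?_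
  · rw [OpenPartialHomeomorph.restr_source' _ _ hWM]
    exact ⟨mem_chart_source H x, mem_chart_source H x, hεa⟩
  · rw [hψs]
    refine ⟨mem_chart_source H' (f x), ?_⟩
    have h1 : extChartAt J (f x) (f x) = ε (e (a, 0)) := by
      rw [hεΨ, hΨe]
      simp [g, writtenInExtChartAt, a]
    change extChartAt J (f x) (f x) ∈ ε.target
    rw [h1]
    exact ε.map_source hεa
  · intro u hu
    have hu' : u ∈ W := by
      have h1 := PartialEquiv.map_target _ hu
      rw [OpenPartialHomeomorph.extend_source, OpenPartialHomeomorph.restr_source' _ _ hWM] at h1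
      have h2 : extChartAt I x ((extChartAt I x).symm u) ∈ W := h1.2.2
      rwa [(extChartAt I x).right_inv] at h2
      rw [OpenPartialHomeomorph.extend_target] at hu
      rw [extChartAt_target]
      exact ⟨hu.1.1, hu.2⟩
    change ψ.extend J (f ((extChartAt I x).symm u)) = e (u, 0)
    rw [hψe]
    change ε.symm (g u) = _
    rw [← hΨe u, ← hεΨ]
    exact ε.left_inv hu'

theorem isImmersion_of_injective_mfderiv {f : M → N} (hf : ContMDiff I J ∞ f)
    (hinj : ∀ x, Injective (mfderiv I J f x)) : IsImmersion I J ∞ f := by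
  refine IsImmersionOfComplement.isImmersion
    (F := EuclideanSpace ℝ (Fin (Module.finrank ℝ E' - Module.finrank ℝ E))) fun x => ?_
  have h1 : Module.finrank ℝ E ≤ Module.finrank ℝ E' :=
    LinearMap.finrank_le_finrank_of_injective
      (f := (show E →L[ℝ] E' from mfderiv I J f x).toLinearMap) (hinj x)
  refine isImmersionAtOfComplement_of_injective_mfderiv _ ?_ hf x (hinj x)
  rw [finrank_euclideanSpace_fin]
  omega

end Target

variable [FiniteDimensional ℝ E] [FiniteDimensional ℝ E₁] [K.Boundaryless] [IsManifold K ∞ S]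

/-- Once `g` is smooth, injectivity of its differential and the embedding property pass from Tf ∘ g
to the inner factor `g`. -/
theorem isSmoothEmbedding_of_tangentMap_comp {f : M → N} (hf : IsSmoothEmbedding I J ∞ f)
    {g : S → TangentBundle I M}
    (hg : IsSmoothEmbedding K J.tangent ∞ fun s => tangentMap I J f (g s)) :
    IsSmoothEmbedding K I.tangent ∞ g := by
  have h1 := contMDiff_of_tangentMap_comp hf hg.contMDiff
  have h2 : ContMDiff I.tangent J.tangent ∞ (tangentMap I J f) :=
    hf.contMDiff.contMDiff_tangentMap (by simp)
  refine ⟨isImmersion_of_injective_mfderiv h1 fun s => ?_, ?_⟩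
  · have h3 := (hg.isImmersion.isImmersionAt s).injective_mfderiv
    have h4 : mfderiv K J.tangent (fun s => tangentMap I J f (g s)) s = _ :=
      mfderiv_comp s (h2.mdifferentiableAt (by simp)) (h1.mdifferentiableAt (by simp))
    rw [h4] at h3
    exact Injective.of_comp h3
  · exact Topology.IsEmbedding.of_comp h1.continuous h2.continuous hg.isEmbedding

end Immersion

/-! ### The dimension count for isotropic subspaces -/

section LinearAlgebra

variable {V : Type*} [NormedAddCommGroup V] [NormedSpace ℝ V]

/-- The bilinear form of an alternating 2-form. -/
def bilinFormOfAlternating (η : V [⋀^Fin 2]→L[ℝ] ℝ) : LinearMap.BilinForm ℝ V :=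
  LinearMap.mk₂ ℝ (fun v w => η ![v, w])
    (fun a b w => η.toMultilinearMap.cons_add ![w] a b)
    (fun c a w => η.toMultilinearMap.cons_smul ![w] c a)
    (fun v a b => by
      have h : ∀ x, update ![v, 0] 1 x = ![v, x] := fun x => by
        funext i; fin_cases i <;> rfl
      simpa only [h] using η.map_update_add ![v, 0] 1 a b)
    (fun c v a => by
      have h : ∀ x, update ![v, 0] 1 x = ![v, x] := fun x => by
        funext i; fin_cases i <;> rfl
      simpa only [h] using η.map_update_smul ![v, 0] 1 c a)

theorem bilinFormOfAlternating_isRefl (η : V [⋀^Fin 2]→L[ℝ] ℝ) :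
    (bilinFormOfAlternating η).IsRefl := by
  refine LinearMap.BilinForm.IsAlt.isRefl fun v => ?_
  exact η.map_eq_zero_of_eq ![v, v] (i := 0) (j := 1) rfl (by decide)

/-- The dimension of an isotropic subspace of `E × E` which projects onto the first factor, for a
2-form for which `i_{(0, b)} η` is the pullback of a 1-form on the first factor. -/
theorem finrank_isotropic_of_surjective_fst [FiniteDimensional ℝ V]
    (η : (V × V) [⋀^Fin 2]→L[ℝ] ℝ) (B : V [⋀^Fin 2]→L[ℝ] ℝ)
    (hη : ∀ (b : V) (w : V × V), η ![(0, b), w] = B ![b, w.1])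
    (L K : Submodule ℝ (V × V)) (hK : ∀ v, v ∈ K ↔ ∀ w, η ![v, w] = 0)
    (hL : ∀ v ∈ L, ∀ w ∈ L, η ![v, w] = 0) (hsurj : ∀ a, ∃ b, (a, b) ∈ L) :
    2 * Module.finrank ℝ L + Module.finrank ℝ K =
      Module.finrank ℝ (V × V) + 2 * Module.finrank ℝ (L ⊓ K : Submodule ℝ (V × V)) := by
  set β := bilinFormOfAlternating η
  have hβ : ∀ v w, β v w = η ![v, w] := fun _ _ => rfl
  have hrefl : β.IsRefl := bilinFormOfAlternating_isRefl η
  have hKo : β.orthogonal ⊤ = K := by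
    ext v
    rw [LinearMap.BilinForm.mem_orthogonal_iff, hK]
    exact ⟨fun h w => hrefl _ _ (h w trivial), fun h w _ => hrefl _ _ (h w)⟩
  have hLo : β.orthogonal L = L ⊔ K := by
    refine le_antisymm (fun v hv => ?_) (sup_le (fun v hv w hw => hL w hw v hv) ?_)
    · obtain ⟨b, hb⟩ := hsurj v.1
      -- The remainder v - (v.1, b) is vertical and orthogonal to `L`. Its pairing with w depends
      -- only on w.1, so w may be replaced by (w.1, c) in `L`, where the pairing vanishes.
      rw [← add_sub_cancel (v.1, b) v]
      refine Submodule.add_mem_sup hb ((hK _).2 fun w => ?_)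
      obtain ⟨c, hc⟩ := hsurj w.1
      have e : v - (v.1, b) = (0, v.2 - b) := by ext <;> simp
      have h1 : β (v - (v.1, b)) (w.1, c) = 0 := by
        rw [map_sub, LinearMap.sub_apply, hrefl _ _ (hv _ hc), hβ, hL _ hb _ hc, sub_zero]
      rw [hβ, e, hη] at h1
      rw [e, hη, h1]
    · rw [← hKo]
      exact LinearMap.BilinForm.orthogonal_le le_top
  have h1 := LinearMap.BilinForm.finrank_add_finrank_orthogonal hrefl L
  rw [hKo, hLo] at h1
  have h2 := Submodule.finrank_sup_add_finrank_inf_eq L K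
  omega

end LinearAlgebra

/-! ### Lagrangian submanifolds of (TM, d_T η) -/

section Lagrangian

variable {E : Type*} [NormedAddCommGroup E] [NormedSpace ℝ E]
  {H : Type*} [TopologicalSpace H] {I : ModelWithCorners ℝ E H}
  {M : Type*} [TopologicalSpace M] [ChartedSpace H M] [IsManifold I ∞ M]

/-- Both sides agree because τ ∘ Tf = f ∘ τ. -/
theorem DiffForm.pullback_iT {k : ℕ} (η : DiffForm I M (k + 1))
    {E' : Type*} [NormedAddCommGroup E'] [NormedSpace ℝ E'] {H' : Type*} [TopologicalSpace H']
    {I' : ModelWithCorners ℝ E' H'} {M' : Type*} [TopologicalSpace M'] [ChartedSpace H' M']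
    [IsManifold I' ∞ M'] {f : M' → M} (hf : ContMDiff I' I ∞ f) :
    DiffForm.pullback (I' := I'.tangent) (tangentMap I' I f) η.iT =
      (DiffForm.pullback (I' := I') f η).iT := by
  funext v
  refine ContinuousAlternatingMap.ext fun w => ?_
  have h0 : ContMDiff I'.tangent I.tangent ∞ (tangentMap I' I f) :=
    hf.contMDiff_tangentMap (by simp)
  have h1 := mfderiv_comp v (g := fun z : TangentBundle I M => z.proj) (f := tangentMap I' I f)
    ((contMDiff_proj (n := 1) (TangentSpace I : M → Type _)).mdifferentiable one_ne_zero _)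
    (h0.mdifferentiableAt (by simp))
  have h2 := mfderiv_comp v (g := f) (f := fun z : TangentBundle I' M' => z.proj)
    (hf.mdifferentiableAt (by simp))
    ((contMDiff_proj (n := 1) (TangentSpace I' : M' → Type _)).mdifferentiable one_ne_zero _)
  have h3 : _ = _ := h1.symm.trans h2
  let ηv : E [⋀^Fin (k + 1)]→L[ℝ] ℝ := η (f v.proj)
  change ηv _ = ηv _
  congr 1
  funext j
  refine Fin.cases rfl (fun j => ?_) j
  exact DFunLike.congr_fun h3 (w j)

variable [I.Boundaryless]

/-- The tangent space at `v` is E × E through the chart centred at `v`, in which the projection is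
the first coordinate. -/
theorem mfderiv_tangentBundle_proj (v : TangentBundle I M) :
    (mfderiv I.tangent I (fun z : TangentBundle I M => z.proj) v : E × E →L[ℝ] E) =
      .fst ℝ E E := by
  have hz := mem_extChartAt_target (I := I.tangent) v
  have h1 := mfderiv_proj_comp_extChartAt_symm (I := I) v hz
  have hv : (extChartAt I.tangent v).symm (extChartAt I.tangent v v) = v := extChartAt_to_inv v
  have h2 : MDifferentiableAt I.tangent I (fun v : TangentBundle I M => v.proj)
      ((extChartAt I.tangent v).symm (extChartAt I.tangent v v)) :=
    (contMDiff_proj (n := 1) (TangentSpace I : M → Type _)).mdifferentiable one_ne_zero _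
  have h3 : MDifferentiableAt 𝓘(ℝ, E × E) I.tangent (extChartAt I.tangent v).symm
      (extChartAt I.tangent v v) :=
    (contMDiffAt_extChartAt_symm (n := 1) hz).mdifferentiableAt one_ne_zero
  have h4 : _ = _ := (mfderiv_comp _ h2 h3).symm.trans h1
  have h5 : (mfderiv 𝓘(ℝ, E × E) I.tangent (extChartAt I.tangent v).symm
      (extChartAt I.tangent v v) : E × E →L[ℝ] E × E) = ContinuousLinearMap.id ℝ (E × E) := by
    have := mfderivWithin_range_extChartAt_symm (I := I.tangent) (x := v)
    rwa [I.tangent.range_eq_univ, mfderivWithin_univ] at this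
  have h6 : (extChartAt I.tangent v v).1 = extChartAt I v.proj v.proj := by
    rw [← (extChartAt I v.proj).right_inv (fst_mem_extChartAt_target hz),
      ← proj_extChartAt_symm v hz, extChartAt_to_inv]
  have h7 : (mfderiv 𝓘(ℝ, E) I (extChartAt I v.proj).symm (extChartAt I v.proj v.proj) :
      E →L[ℝ] E) = ContinuousLinearMap.id ℝ E := by
    have := mfderivWithin_range_extChartAt_symm (I := I) (x := v.proj)
    rwa [I.range_eq_univ, mfderivWithin_univ] at this
  rw [h6] at h4
  have key : ∀ (w : TangentBundle I M) (D : E × E →L[ℝ] E × E) (D' : E →L[ℝ] E), w = v →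
      D = ContinuousLinearMap.id ℝ (E × E) → D' = ContinuousLinearMap.id ℝ E →
      (mfderiv I.tangent I (fun z : TangentBundle I M => z.proj) w : E × E →L[ℝ] E).comp D =
        D'.comp (.fst ℝ E E) →
      (mfderiv I.tangent I (fun z : TangentBundle I M => z.proj) v : E × E →L[ℝ] E) =
        .fst ℝ E E := by
    rintro _ _ _ rfl rfl rfl h
    exact h
  exact key _ _ _ hv h5 h7 h4

/-- An embedded isotropic submanifold of `(TM, d_T η)` which submerses onto `M` is Lagrangian. -/
theorem isLagrangian_dT [FiniteDimensional ℝ E] {η : DiffForm I M 2} (hη : IsPresymplectic η)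
    {E₁ : Type*} [NormedAddCommGroup E₁] [NormedSpace ℝ E₁]
    {H₁ : Type*} [TopologicalSpace H₁] {K : ModelWithCorners ℝ E₁ H₁} [K.Boundaryless]
    {S : Type*} [TopologicalSpace S] [ChartedSpace H₁ S] [IsManifold K ∞ S]
    {f : S → TangentBundle I M} (hf : IsSmoothEmbedding K I.tangent ∞ f)
    (hiso : ∀ s, DiffForm.pullback (I' := K) f η.dT s = 0)
    (hsub : ∀ s, Surjective (mfderiv K I (fun s => (f s).proj) s)) :
    IsLagrangian K η.dT f := by
  refine ⟨hf, hiso, fun s => ?_⟩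
  let D : E₁ →L[ℝ] E × E := mfderiv K I.tangent f s
  have hD : Injective D := (hf.isImmersion.isImmersionAt s).injective_mfderiv
  let ηs : (E × E) [⋀^Fin 2]→L[ℝ] ℝ := η.dT (f s)
  let Ks : Submodule ℝ (E × E) := kerAt η.dT (f s)
  have hsurj : ∀ a, ∃ b, (a, b) ∈ LinearMap.range (D : E₁ →ₗ[ℝ] E × E) := by
    intro a
    obtain ⟨w, hw⟩ := hsub s a
    have h1 := mfderiv_comp s (g := fun z : TangentBundle I M => z.proj) (f := f)
      ((contMDiff_proj (n := 1) (TangentSpace I : M → Type _)).mdifferentiable one_ne_zero _)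
      (hf.contMDiff.mdifferentiableAt (by simp))
    have h2 : (D w).1 = a := by
      refine Eq.trans ?_ hw
      exact ((DFunLike.congr_fun (mfderiv_tangentBundle_proj (f s)) (D w)).symm.trans
        (DFunLike.congr_fun h1 w).symm)
    exact ⟨(D w).2, w, Prod.ext h2 rfl⟩
  have h := finrank_isotropic_of_surjective_fst ηs (η (f s).proj)
    (dT_apply_vertical hη (f s)) (LinearMap.range (D : E₁ →ₗ[ℝ] E × E)) Ks (fun v => Iff.rfl)
    (by
      rintro _ ⟨a, rfl⟩ _ ⟨b, rfl⟩
      have h1 := DFunLike.congr_fun (hiso s) ![a, b]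
      refine Eq.trans ?_ h1
      change ηs _ = ηs _
      congr 1
      funext i
      fin_cases i <;> rfl) hsurj
  rw [LinearMap.finrank_range_of_inj hD] at h
  have h' : (2 : ℚ) * Module.finrank ℝ E₁ + Module.finrank ℝ Ks = Module.finrank ℝ (E × E) +
      2 * Module.finrank ℝ (LinearMap.range (D : E₁ →ₗ[ℝ] E × E) ⊓ Ks : Submodule ℝ (E × E)) := by
    exact_mod_cast h
  change (Module.finrank ℝ E₁ : ℚ) = ((Module.finrank ℝ (E × E) : ℚ) - Module.finrank ℝ Ks) / 2 +
    Module.finrank ℝ (LinearMap.range (D : E₁ →ₗ[ℝ] E × E) ⊓ Ks : Submodule ℝ (E × E))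
  linarith

end Lagrangian

/-! ### Contraction of a 2-form in coordinates -/

section Contraction

variable {E : Type*} [NormedAddCommGroup E] [NormedSpace ℝ E]

/-- The contraction of a 2-form on a vector space with tangent vectors, as a 1-form depending on
the tangent vector. -/
def contractVector (Ω : E → E [⋀^Fin 2]→L[ℝ] ℝ) (z : E × E) : E →L[ℝ] ℝ :=
  (ContinuousAlternatingMap.ofSubsingleton ℝ E ℝ (0 : Fin 1)).symm ((Ω z.1).curryLeft z.2)

theorem contractVector_apply (Ω : E → E [⋀^Fin 2]→L[ℝ] ℝ) (z : E × E) (w : E) :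
    contractVector Ω z w = Ω z.1 ![z.2, w] := by
  change Ω z.1 _ = Ω z.1 _
  congr 1
  funext i
  fin_cases i <;> rfl

theorem contDiffAt_contractVector {Ω : E → E [⋀^Fin 2]→L[ℝ] ℝ} {z : E × E}
    (hΩ : ContDiffAt ℝ ∞ Ω z.1) : ContDiffAt ℝ ∞ (contractVector Ω) z := by
  have h2 : ContDiffAt ℝ ∞ (fun z : E × E => Ω z.1) z := hΩ.comp z contDiffAt_fst
  have h3 : ContDiffAt ℝ ∞ (fun z : E × E => (Ω z.1).curryLeft z.2) z :=
    ContDiffAt.clm_apply (f := fun z : E × E => (Ω z.1).curryLeft)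
      (ContDiffAt.comp z (g := ContinuousAlternatingMap.curryLeftLI (𝕜 := ℝ) (E := E)
        (F := ℝ) (n := 1)) (LinearIsometry.contDiff _).contDiffAt h2) contDiffAt_snd
  exact ContDiffAt.comp z (g := (ContinuousAlternatingMap.ofSubsingletonLIE (𝕜 := ℝ)
    (E := E) (F := ℝ) (0 : Fin 1)).symm) (LinearIsometryEquiv.contDiff _).contDiffAt h3

variable {H : Type*} [TopologicalSpace H] {I : ModelWithCorners ℝ E H} [I.Boundaryless]
  {M : Type*} [TopologicalSpace M] [ChartedSpace H M]

theorem contractVector_inChart (η : DiffForm I M 2) (x₀ : M) (z : E × E) (w : E) :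
    contractVector (η.inChart x₀) z w =
      (ContinuousAlternatingMap.ofSubsingleton ℝ E ℝ (0 : Fin 1)).symm
        (contract (η ((extChartAt I x₀).symm z.1))
          ((mfderiv 𝓘(ℝ, E) I (extChartAt I x₀).symm z.1 : E →L[ℝ] E) z.2))
        ((mfderiv 𝓘(ℝ, E) I (extChartAt I x₀).symm z.1 : E →L[ℝ] E) w) := by
  rw [contractVector_apply, DiffForm.inChart_eq_pullback]
  let η' : E [⋀^Fin 2]→L[ℝ] ℝ := η ((extChartAt I x₀).symm z.1)
  change η' _ = η' _
  congr 1
  funext i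
  fin_cases i <;> rfl

/-- This brings the pullback of i_T η to the shape ⟨Ξ, dA⟩ required by `extDeriv_eq_zero_of_morse`:
`A` is the base coordinate and `Ξ` the contraction. -/
theorem DiffForm.inChart_pullback_iT [IsManifold I ∞ M] (η : DiffForm I M 2)
    {E₁ : Type*} [NormedAddCommGroup E₁] [NormedSpace ℝ E₁]
    {H₁ : Type*} [TopologicalSpace H₁] {K : ModelWithCorners ℝ E₁ H₁} [K.Boundaryless]
    {S : Type*} [TopologicalSpace S] [ChartedSpace H₁ S] [IsManifold K ∞ S]
    {j : S → TangentBundle I M} (hj : ContMDiff K I.tangent ∞ j) {s₀ : S} {v₀ : TangentBundle I M}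
    {y : E₁} (hy : y ∈ (extChartAt K s₀).target)
    (hjy : j ((extChartAt K s₀).symm y) ∈ (extChartAt I.tangent v₀).source) :
    (DiffForm.pullback (I' := K) j η.iT).inChart s₀ y =
      ContinuousAlternatingMap.ofSubsingleton ℝ E₁ ℝ (0 : Fin 1)
        ((contractVector (η.inChart v₀.proj)
            ((extChartAt I.tangent v₀ ∘ j ∘ (extChartAt K s₀).symm) y)).comp
          (fderiv ℝ (fun y => ((extChartAt I.tangent v₀ ∘ j ∘ (extChartAt K s₀).symm) y).1) y)) := by
  have hY := writtenInCharts_contDiffAt hy hj.contMDiffAt hjy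
  have hYt : (extChartAt I.tangent v₀ ∘ j ∘ (extChartAt K s₀).symm) y ∈
    (extChartAt I.tangent v₀).target := (extChartAt I.tangent v₀).map_source hjy
  rw [DiffForm.inChart_pullback _ hy (hj.mdifferentiableAt (by simp)) hjy,
    DiffForm.inChart_iT _ _ hYt]
  generalize extChartAt I.tangent v₀ ∘ j ∘ (extChartAt K s₀).symm = Y at hY hYt ⊢
  have h1 : fderiv ℝ (fun y => (Y y).1) y = (ContinuousLinearMap.fst ℝ E E).comp (fderiv ℝ Y y) :=
    ((hasFDerivAt_fst (p := Y y)).comp y (hY.differentiableAt (by simp)).hasFDerivAt).fderiv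
  rw [h1]
  refine ContinuousAlternatingMap.ext fun w => ?_
  refine Eq.trans ?_ (contractVector_apply (η.inChart v₀.proj) (Y y) (fderiv ℝ Y y (w 0)).1).symm
  change η.inChart v₀.proj (Y y).1 _ = η.inChart v₀.proj (Y y).1 _
  congr 1
  funext i
  fin_cases i <;> rfl

end Contraction

/-! ### Pontryagin's Hamiltonian in charts and isotropy of the dynamics -/

namespace OptimalControlProblem

variable {n m : ℕ} {Q : Type*} [TopologicalSpace Q]
    [ChartedSpace (EuclideanSpace ℝ (Fin n)) Q] [IsManifold (𝓡 n) ∞ Q]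
    (C : OptimalControlProblem n m Q)

/-- The model vector space of the cotangent bundle. -/
local notation "𝔼" => EuclideanSpace ℝ (Fin n) × (EuclideanSpace ℝ (Fin n) →L[ℝ] ℝ)

local notation "𝕌" => EuclideanSpace ℝ (Fin m)

theorem contMDiffAt_hamiltonian (α : Cotangent (𝓡 n) Q) {u : 𝕌} (hu : u ∈ interior C.U) :
    ContMDiffAt ((cotangentModel (𝓡 n)).prod (𝓡 m)) 𝓘(ℝ, ℝ) ∞
      (fun z : Cotangent (𝓡 n) Q × 𝕌 => C.hamiltonian z.1 z.2) (α, u) := by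
  have hnhds : (univ ×ˢ interior C.U : Set (Q × 𝕌)) ∈ 𝓝 (α.proj, u) :=
    (isOpen_univ.prod isOpen_interior).mem_nhds ⟨trivial, hu⟩
  have hb : ContMDiffAt ((cotangentModel (𝓡 n)).prod (𝓡 m)) ((𝓡 n).prod (𝓡 m)) ∞
      (fun z : Cotangent (𝓡 n) Q × 𝕌 => (z.1.proj, z.2)) (α, u) := by
    refine ContMDiffAt.prodMk ?_ contMDiffAt_snd
    exact (contMDiff_proj (fun x : Q => TangentSpace (𝓡 n) x →L[ℝ] Trivial Q ℝ x)).contMDiffAt.comp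
      (α, u) contMDiffAt_fst
  have hX := (C.smooth_X.contMDiffAt hnhds).comp (α, u) hb
  have hF := (C.smooth_F.contMDiffAt hnhds).comp (α, u) hb
  have h1 : ContMDiffAt ((cotangentModel (𝓡 n)).prod (𝓡 m)) ((𝓡 n).prod 𝓘(ℝ, ℝ)) ∞
      (fun z : Cotangent (𝓡 n) Q × 𝕌 => TotalSpace.mk' ℝ (E := Trivial Q ℝ) z.1.proj
        ((z.1.snd : TangentSpace (𝓡 n) z.1.proj →L[ℝ] Trivial Q ℝ z.1.proj)
          (C.X z.1.proj z.2))) (α, u) :=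
    ContMDiffAt.clm_bundle_apply (F₁ := EuclideanSpace ℝ (Fin n)) (F₂ := ℝ)
      (E₁ := (TangentSpace (𝓡 n) : Q → Type _)) (E₂ := Trivial Q ℝ)
      (b := fun z : Cotangent (𝓡 n) Q × 𝕌 => z.1.proj)
      (ϕ := fun z => z.1.snd) (v := fun z => C.X z.1.proj z.2) contMDiffAt_fst hX
  exact (contMDiffAt_totalSpace.1 h1).2.sub hF

/-- The Hamiltonian in the chart of the cotangent bundle centred at `α₀`. -/
def localHamiltonian (α₀ : Cotangent (𝓡 n) Q) (z : 𝔼 × 𝕌) : ℝ :=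
  C.hamiltonian ((extChartAt (cotangentModel (𝓡 n)) α₀).symm z.1) z.2

/-- The domain of the Hamiltonian in the chart of the cotangent bundle centred at `α₀`. -/
def localDomain (α₀ : Cotangent (𝓡 n) Q) : Set (𝔼 × 𝕌) :=
  (extChartAt (cotangentModel (𝓡 n)) α₀).target ×ˢ interior C.U

theorem isOpen_localDomain (α₀ : Cotangent (𝓡 n) Q) : IsOpen (C.localDomain α₀) :=
  (isOpen_extChartAt_target α₀).prod isOpen_interior

theorem contMDiffAt_extChartAt_symm_prod (α₀ : Cotangent (𝓡 n) Q) {z : 𝔼 × 𝕌}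
    (hz : z.1 ∈ (extChartAt (cotangentModel (𝓡 n)) α₀).target) :
    ContMDiffAt 𝓘(ℝ, 𝔼 × 𝕌) ((cotangentModel (𝓡 n)).prod (𝓡 m)) ∞
      (fun z : 𝔼 × 𝕌 => ((extChartAt (cotangentModel (𝓡 n)) α₀).symm z.1, z.2)) z :=
  ContMDiffAt.prodMk ((contMDiffAt_extChartAt_symm hz).comp z contDiff_fst.contMDiff.contMDiffAt)
    contDiff_snd.contMDiff.contMDiffAt

theorem contDiffOn_localHamiltonian (α₀ : Cotangent (𝓡 n) Q) :
    ContDiffOn ℝ ∞ (C.localHamiltonian α₀) (C.localDomain α₀) := by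
  intro z hz
  refine ContDiffAt.contDiffWithinAt ?_
  rw [← contMDiffAt_iff_contDiffAt]
  exact (C.contMDiffAt_hamiltonian _ hz.2).comp z (contMDiffAt_extChartAt_symm_prod α₀ hz.1)

theorem hasFDerivAt_localHamiltonian (α₀ : Cotangent (𝓡 n) Q) {z : 𝔼 × 𝕌}
    (hz : z ∈ C.localDomain α₀) :
    HasFDerivAt (C.localHamiltonian α₀) (fderiv ℝ (C.localHamiltonian α₀) z) z :=
  (((C.contDiffOn_localHamiltonian α₀).contDiffAt
    ((C.isOpen_localDomain α₀).mem_nhds hz)).differentiableAt (by simp)).hasFDerivAt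

theorem fderiv_localHamiltonian_comp_inr (α₀ : Cotangent (𝓡 n) Q) {z : 𝔼 × 𝕌}
    (hz : z ∈ C.localDomain α₀) :
    (fderiv ℝ (C.localHamiltonian α₀) z).comp (.inr ℝ 𝔼 𝕌) =
      C.dHdu ((extChartAt (cotangentModel (𝓡 n)) α₀).symm z.1, z.2) := by
  have h1 : HasFDerivAt (fun u : 𝕌 => (z.1, u)) (.inr ℝ 𝔼 𝕌) z.2 := hasFDerivAt_prodMk_right z.1 z.2
  exact ((C.hasFDerivAt_localHamiltonian α₀ hz).comp z.2 h1).fderiv.symm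

theorem fderiv_localHamiltonian_comp_inl (α₀ : Cotangent (𝓡 n) Q) {z : 𝔼 × 𝕌}
    (hz : z ∈ C.localDomain α₀) :
    (fderiv ℝ (C.localHamiltonian α₀) z).comp (.inl ℝ 𝔼 𝕌) =
      (mfderiv (cotangentModel (𝓡 n)) 𝓘(ℝ, ℝ) (fun α => C.hamiltonian α z.2)
        ((extChartAt (cotangentModel (𝓡 n)) α₀).symm z.1) : 𝔼 →L[ℝ] ℝ).comp
      (mfderiv 𝓘(ℝ, 𝔼) (cotangentModel (𝓡 n)) (extChartAt (cotangentModel (𝓡 n)) α₀).symm z.1 :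
        𝔼 →L[ℝ] 𝔼) := by
  have h1 : HasFDerivAt (fun a : 𝔼 => (a, z.2)) (.inl ℝ 𝔼 𝕌) z.1 := hasFDerivAt_prodMk_left z.1 z.2
  have h2 := ((C.hasFDerivAt_localHamiltonian α₀ hz).comp z.1 h1).fderiv
  have h3 : ContMDiffAt (cotangentModel (𝓡 n)) 𝓘(ℝ, ℝ) ∞ (fun α => C.hamiltonian α z.2)
      ((extChartAt (cotangentModel (𝓡 n)) α₀).symm z.1) :=
    ContMDiffAt.comp (I' := (cotangentModel (𝓡 n)).prod (𝓡 m)) _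
      (g := fun w : Cotangent (𝓡 n) Q × 𝕌 => C.hamiltonian w.1 w.2) (f := fun α => (α, z.2))
      (C.contMDiffAt_hamiltonian _ hz.2) (contMDiffAt_id.prodMk contMDiffAt_const)
  have h4 := mfderiv_comp z.1 (h3.mdifferentiableAt (by simp))
    ((contMDiffAt_extChartAt_symm (n := ∞) hz.1).mdifferentiableAt (by simp))
  rw [mfderiv_eq_fderiv] at h4
  exact h2.symm.trans h4

/-- Near the point ∂H/∂u is the local expression composed with the chart, and surjectivity of a
composite passes to its outer factor. -/
theorem IsMorseFamily.surjective_fderiv {C : OptimalControlProblem n m Q} (hC : C.IsMorseFamily)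
    (α₀ : Cotangent (𝓡 n) Q) {z : 𝔼 × 𝕌} (hz : z ∈ C.localDomain α₀)
    (hz0 : (fderiv ℝ (C.localHamiltonian α₀) z).comp (.inr ℝ 𝔼 𝕌) = 0) :
    Surjective (fderiv ℝ (fun z => (fderiv ℝ (C.localHamiltonian α₀) z).comp (.inr ℝ 𝔼 𝕌)) z) := by
  set ψ := extChartAt (cotangentModel (𝓡 n)) α₀ with hψ
  set G : 𝔼 × 𝕌 → 𝕌 →L[ℝ] ℝ :=
    fun z => (fderiv ℝ (C.localHamiltonian α₀) z).comp (.inr ℝ 𝔼 𝕌) with hG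
  set α := ψ.symm z.1 with hα
  have hαs : α ∈ ψ.source := ψ.map_target hz.1
  have hψα : ψ α = z.1 := ψ.right_inv hz.1
  have h1 := hC α z.2 hz.2 ((C.fderiv_localHamiltonian_comp_inr α₀ hz).symm.trans hz0)
  let Φ : Cotangent (𝓡 n) Q × 𝕌 → 𝔼 × 𝕌 := fun w => (ψ w.1, w.2)
  have hΦ : ContMDiffAt ((cotangentModel (𝓡 n)).prod (𝓡 m)) 𝓘(ℝ, 𝔼 × 𝕌) ∞ Φ (α, z.2) := by
    refine ContMDiffAt.prodMk_space ?_ contMDiffAt_snd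
    exact (contMDiffAt_extChartAt' (by rwa [hψ, extChartAt_source] at hαs)).comp (α, z.2)
      contMDiffAt_fst
  have hΦz : Φ (α, z.2) = z := Prod.ext hψα rfl
  have hGz : DifferentiableAt ℝ G z := by
    have h2 := ((C.contDiffOn_localHamiltonian α₀).contDiffAt
      ((C.isOpen_localDomain α₀).mem_nhds hz)).fderiv_right (m := ∞) (by simp)
    exact (h2.clm_comp contDiffAt_const).differentiableAt (by simp)
  have h3 : C.dHdu =ᶠ[𝓝 (α, z.2)] G ∘ Φ := by
    have h4 : (ψ.source ×ˢ interior C.U : Set (Cotangent (𝓡 n) Q × 𝕌)) ∈ 𝓝 (α, z.2) :=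
      ((isOpen_extChartAt_source α₀).prod isOpen_interior).mem_nhds ⟨hαs, hz.2⟩
    filter_upwards [h4] with w hw
    have h5 := C.fderiv_localHamiltonian_comp_inr α₀ (z := Φ w) ⟨ψ.map_source hw.1, hw.2⟩
    refine Eq.trans ?_ h5.symm
    change C.dHdu w = C.dHdu (ψ.symm (ψ w.1), w.2)
    rw [ψ.left_inv hw.1]
  have hGm : MDifferentiableAt 𝓘(ℝ, 𝔼 × 𝕌) 𝓘(ℝ, 𝕌 →L[ℝ] ℝ) G (Φ (α, z.2)) := by
    rw [hΦz]
    exact hGz.mdifferentiableAt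
  rw [h3.mfderiv_eq, mfderiv_comp (α, z.2) hGm (hΦ.mdifferentiableAt (by simp)), hΦz,
    mfderiv_eq_fderiv] at h1
  exact Surjective.of_comp h1

/-- Membership in the dynamics fixes the differential of H along the cotangent bundle and kills it
along the controls; together these give the full differential, as hypothesis `hex` of
`extDeriv_eq_zero_of_morse` demands. -/
theorem exists_fderiv_localHamiltonian_eq
    (v₀ : TangentBundle (cotangentModel (𝓡 n)) (Cotangent (𝓡 n) Q)) {z : 𝔼 × 𝔼}
    (hz : z ∈ (extChartAt (cotangentModel (𝓡 n)).tangent v₀).target)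
    (hdyn : (extChartAt (cotangentModel (𝓡 n)).tangent v₀).symm z ∈ C.dynamics) :
    ∃ u, (z.1, u) ∈ C.localDomain v₀.proj ∧ fderiv ℝ (C.localHamiltonian v₀.proj) (z.1, u) =
      (contractVector ((canonicalTwoForm (𝓡 n) Q).inChart v₀.proj) z).comp (.fst ℝ 𝔼 𝕌) := by
  have hz1 := fst_mem_extChartAt_target hz
  rw [extChartAt_tangent_symm v₀ hz] at hdyn
  obtain ⟨u, hu, hu0, hd⟩ := hdyn
  have hO : (z.1, u) ∈ C.localDomain v₀.proj := ⟨hz1, hu⟩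
  refine ⟨u, hO, ?_⟩
  have h1 := C.fderiv_localHamiltonian_comp_inr v₀.proj hO
  have h2 := C.fderiv_localHamiltonian_comp_inl v₀.proj hO
  have h3 := h1.trans hu0
  refine ContinuousLinearMap.ext fun w => ?_
  have h4 : fderiv ℝ (C.localHamiltonian v₀.proj) (z.1, u) w =
      (fderiv ℝ (C.localHamiltonian v₀.proj) (z.1, u)).comp (.inl ℝ 𝔼 𝕌) w.1 +
      (fderiv ℝ (C.localHamiltonian v₀.proj) (z.1, u)).comp (.inr ℝ 𝔼 𝕌) w.2 := by
    simp only [ContinuousLinearMap.comp_apply, ← map_add]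
    simp
  rw [h4, h3, h2]
  refine (add_zero _).trans ((DFunLike.congr_fun hd _).symm.trans ?_)
  exact (contractVector_inChart (canonicalTwoForm (𝓡 n) Q) v₀.proj z w.1).symm

/-- The dynamics is isotropic for the complete lift of the canonical 2-form. -/
theorem d_pullback_iT_eq_zero {C : OptimalControlProblem n m Q} (hC : C.IsMorseFamily)
    {E₁ : Type*} [NormedAddCommGroup E₁] [NormedSpace ℝ E₁] [FiniteDimensional ℝ E₁]
    {H₁ : Type*} [TopologicalSpace H₁] {K : ModelWithCorners ℝ E₁ H₁} [K.Boundaryless]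
    {S : Type*} [TopologicalSpace S] [ChartedSpace H₁ S] [IsManifold K ∞ S]
    {j : S → TangentBundle (cotangentModel (𝓡 n)) (Cotangent (𝓡 n) Q)}
    (hj : ContMDiff K (cotangentModel (𝓡 n)).tangent ∞ j) (hjC : ∀ s, j s ∈ C.dynamics) (s₀ : S) :
    (DiffForm.pullback (I' := K) j (canonicalTwoForm (𝓡 n) Q).iT).d s₀ = 0 := by
  have hω := (canonicalTwoForm_isPresymplectic (𝓡 n) Q).smooth
  set φ := extChartAt K s₀ with hφ
  set χ := extChartAt (cotangentModel (𝓡 n)).tangent (j s₀) with hχ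
  let B : Set E₁ := φ.target ∩ φ.symm ⁻¹' (j ⁻¹' χ.source)
  have hB : IsOpen B := (continuousOn_extChartAt_symm s₀).isOpen_inter_preimage
    (isOpen_extChartAt_target s₀) ((isOpen_extChartAt_source (j s₀)).preimage hj.continuous)
  let Y : E₁ → 𝔼 × 𝔼 := χ ∘ j ∘ φ.symm
  have hY : ∀ y ∈ B, ContDiffAt ℝ ∞ Y y := fun y hy =>
    writtenInCharts_contDiffAt hy.1 hj.contMDiffAt hy.2
  have hYt : ∀ y ∈ B, Y y ∈ χ.target := fun y hy => χ.map_source hy.2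
  rw [DiffForm.d_eq]
  refine extDeriv_eq_zero_of_morse (C.isOpen_localDomain (j s₀).proj)
    (C.contDiffOn_localHamiltonian (j s₀).proj)
    (fun z hz => hC.surjective_fderiv (j s₀).proj hz) hB (A := fun y => (Y y).1)
    (Ξ := fun y => contractVector ((canonicalTwoForm (𝓡 n) Q).inChart (j s₀).proj) (Y y)) ?_ ?_ ?_ ?_ ?_ _ ⟨mem_extChartAt_target s₀, ?_⟩
  · exact fun y hy => (contDiffAt_fst.comp y (hY y hy)).contDiffWithinAt
  · intro y hy
    exact ((contDiffAt_contractVector (hω.contDiffAt (fst_mem_extChartAt_target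
      (hYt y hy)))).comp y (hY y hy)).contDiffWithinAt
  · intro y hy
    refine C.exists_fderiv_localHamiltonian_eq (j s₀) (hYt y hy) ?_
    have h1 : χ.symm (Y y) = j (φ.symm y) := χ.left_inv hy.2
    rw [← hχ, h1]
    exact hjC _
  · intro y hy
    exact ((hω.iT.pullback hj).contDiffAt hy.1).contDiffWithinAt
  · exact fun y hy => DiffForm.inChart_pullback_iT _ hj hy.1 hy.2
  · change j (φ.symm (φ s₀)) ∈ χ.source
    rw [hφ, extChartAt_to_inv]
    exact mem_extChartAt_source (j s₀)

end OptimalControlProblem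

end PresymplecticOCP

end

/-! ### The final constraint set is Lagrangian -/

theorem PresymplecticOCP.OptimalControlProblem.algS_subset_dynamics {n m : ℕ} {Q : Type*}
    [TopologicalSpace Q] [ChartedSpace (EuclideanSpace ℝ (Fin n)) Q] [IsManifold (𝓡 n) ∞ Q]
    (C : PresymplecticOCP.OptimalControlProblem n m Q) (k : ℕ) : C.algS k ⊆ C.dynamics := by
  induction k with
  | zero => exact subset_rfl
  | succ k ih => exact inter_subset_right.trans ih

open PresymplecticOCP in
theorem mainTheorem1 {n m d r : ℕ} {Q : Type*} [TopologicalSpace Q] [T2Space Q]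
    [SecondCountableTopology Q] [ChartedSpace (EuclideanSpace ℝ (Fin n)) Q]
    [IsManifold (𝓡 n) ∞ Q]
    (C : PresymplecticOCP.OptimalControlProblem n m Q)
    -- Pontryagin's Hamiltonian is a Morse family
    (hMorse : C.IsMorseFamily)
    -- the algorithm stabilizes at step `k`
    (k : ℕ)
    (hstab : C.algS k =
      PresymplecticOCP.tangentSet (PresymplecticOCP.cotangentModel (𝓡 n)) (C.algP k) ∩ C.algS k)
    -- the final set `P_H^f` is a submanifold of `T^*Q`, with inclusion `i`
    {P : Type*} [TopologicalSpace P] [ChartedSpace (EuclideanSpace ℝ (Fin d)) P]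
    [IsManifold (𝓡 d) ∞ P]
    (i : P → PresymplecticOCP.Cotangent (𝓡 n) Q)
    (hi : Manifold.IsSmoothEmbedding (𝓡 d) (PresymplecticOCP.cotangentModel (𝓡 n)) ∞ i)
    (hiP : Set.range i = C.algP k)
    -- the final set `S_H^f` is a submanifold of `TT^*Q`, with inclusion `j`
    {S : Type*} [TopologicalSpace S] [ChartedSpace (EuclideanSpace ℝ (Fin r)) S]
    [IsManifold (𝓡 r) ∞ S]
    (j : S → TangentBundle (PresymplecticOCP.cotangentModel (𝓡 n))
      (PresymplecticOCP.Cotangent (𝓡 n) Q))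
    (hj : Manifold.IsSmoothEmbedding (𝓡 r) (PresymplecticOCP.cotangentModel (𝓡 n)).tangent ∞ j)
    (hjS : Set.range j = C.algS k)
    -- the projection `ρ : S_H^f → P_H^f` induced by `TT^*Q → T^*Q` is a submersion
    (ρ : S → P) (hρ : ∀ s, i (ρ s) = (j s).proj)
    (hsub : ∀ s, Function.Surjective (mfderiv (𝓡 r) (𝓡 d) ρ s)) :
    let ωf : PresymplecticOCP.DiffForm (𝓡 d) P 2 :=
      PresymplecticOCP.DiffForm.pullback i (PresymplecticOCP.canonicalTwoForm (𝓡 n) Q)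
    PresymplecticOCP.IsPresymplectic ωf ∧
      PresymplecticOCP.IsPresymplectic ωf.dT ∧
      ∃ jf : S → TangentBundle (𝓡 d) P,
        (∀ s, tangentMap (𝓡 d) (PresymplecticOCP.cotangentModel (𝓡 n)) i (jf s) = j s) ∧
        PresymplecticOCP.IsLagrangian (𝓡 r) ωf.dT jf := by
  intro ωf
  have hω := canonicalTwoForm_isPresymplectic (𝓡 n) Q
  have hωf : IsPresymplectic ωf := hω.pullback hi.contMDiff
  have hjk : ∀ s, j s ∈ C.algS k := fun s => hjS ▸ mem_range_self s
  have hdyn : ∀ s, j s ∈ C.dynamics := fun s => C.algS_subset_dynamics k (hjk s)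
  have hlift : ∀ s, ∃ w : TangentBundle (𝓡 d) P,
      tangentMap (𝓡 d) (cotangentModel (𝓡 n)) i w = j s := by
    intro s
    -- Stabilization enters only here: it makes j(s) tangent to the final set P_H^f.
    refine exists_tangentMap_eq_of_mem_tangentSet hi ?_
    rw [hiP]
    exact (hstab ▸ hjk s : j s ∈ tangentSet (cotangentModel (𝓡 n)) (C.algP k) ∩ C.algS k).1
  choose jf hjf using hlift
  obtain rfl : (fun s => tangentMap (𝓡 d) (cotangentModel (𝓡 n)) i (jf s)) = j := funext hjf
  have hjf' : IsSmoothEmbedding (𝓡 r) (𝓡 d).tangent ∞ jf :=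
    isSmoothEmbedding_of_tangentMap_comp hi hj
  refine ⟨hωf, hωf.dT, jf, hjf, isLagrangian_dT hωf hjf' (fun s => ?_) fun s => ?_⟩
  · have hi' : ContMDiff (𝓡 d).tangent (cotangentModel (𝓡 n)).tangent ∞
        (tangentMap (𝓡 d) (cotangentModel (𝓡 n)) i) := hi.contMDiff.contMDiff_tangentMap (by simp)
    -- Transfers isotropy from TP_H^f to TT^*Q, where the Hamiltonian describes the one-form.
    have h1 : DiffForm.pullback (I' := 𝓡 r) jf ωf.iT =
        DiffForm.pullback (I' := 𝓡 r) (fun s => tangentMap (𝓡 d) (cotangentModel (𝓡 n)) i (jf s))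
          (canonicalTwoForm (𝓡 n) Q).iT := by
      funext s
      refine Eq.trans ?_ (DiffForm.pullback_comp (canonicalTwoForm (𝓡 n) Q).iT
        (hi'.mdifferentiableAt (by simp)) (hjf'.contMDiff.mdifferentiableAt (by simp))).symm
      rw [DiffForm.pullback_iT (canonicalTwoForm (𝓡 n) Q) hi.contMDiff]
      rfl
    rw [dT_eq_of_isPresymplectic hωf, ← DiffForm.d_pullback hωf.smooth.iT hjf'.contMDiff.contMDiffAt,
      h1]
    exact OptimalControlProblem.d_pullback_iT_eq_zero hMorse hj.contMDiff hdyn s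
  -- Injectivity of `i` identifies the base point of `jf` with `ρ`, so the submersion hypothesis
  -- applies.
  · have h1 : (fun s => (jf s).proj) = ρ := funext fun s => hi.isEmbedding.injective (hρ s).symm
    rw [h1]
    exact hsub s
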